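/- Let $f:\mathbb{R}^m\times\mathbb{R}^n\to\mathbb{R}$ be $\ell$-smooth ($\ell>0$; differentiable with $\ell$-Lipschitz gradient), with $f(\cdot,\mathbf y)$ $L$-Lipschitz for each $\mathbf y\in\mathcal Y$ and $f(\mathbf x,\cdot)$ concave for each $\mathbf x$, where $\mathcal Y\subset\mathbb{R}^n$ is nonempty, closed, convex and bounded with diameter $D\ge 0$. Put $\Phi(\mathbf x)=\max_{\mathbf y\in\mathcal Y}f(\mathbf x,\mathbf y)$, assumed bounded below, let $\Phi_{1/2\ell}(\mathbf x)=\min_{\mathbf w}\{\Phi(\mathbf w)+\ell\|\mathbf w-\mathbf x\|^2\}$ be its Moreau envelope, and put $\widehat\Delta_\Phi=\Phi_{1/2\ell}(\mathbf x_0)-\inf_{\mathbf x}\Phi_{1/2\ell}(\mathbf x)$. Let $G=(G_{\mathbf x},G_{\mathbf y})$ be a stochastic oracle with $\mathbb E[G(\mathbf x,\mathbf y,\xi)]=\nabla f(\mathbf x,\mathbf y)$ and $\mathbb E\|G(\mathbf x,\mathbf y,\xi)-\nabla f(\mathbf x,\mathbf y)\|^2\le\sigma^2$ for all $(\mathbf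 x,\mathbf y)$, where $\sigma\ge 0$ and $L^2+\sigma^2>0$. Let $\epsilon>0$ and $$\zeta=\frac{\epsilon^2}{24\ell},\qquad \eta_{\mathbf x}=\frac{\epsilon^2}{12\,\ell(L^2+\sigma^2)},\qquad \eta_{\mathbf y}=\min\Big\{\frac1{2\ell},\frac{\zeta}{2\sigma^2}\Big\}\quad\Big(\eta_{\mathbf y}=\frac1{2\ell}\text{ if }\sigma=0\Big).$$ SGDmax (batch size $1$), started at $\mathbf x_0$, does the following at step $t=0,1,\dots$: a max-oracle supplies $\mathbf y_t\in\mathcal Y$, possibly random, with $\mathbb E[f(\mathbf x_t,\mathbf y_t)\mid\mathbf x_t]\ge\Phi(\mathbf x_t)-\zeta$; a sample $\xi_t$ independent of everything generated so far (including $\mathbf x_t,\mathbf y_t$) is drawn; and $\mathbf x_{t+1}=\mathbf x_t-\eta_{\mathbf x}G_{\mathbf x}(\mathbf x_t,\mathbf y_t,\xi_t)$. After $T$ iterations the method returns $\hat{\mathbf x}$ drawn uniformly from $\mathbf x_0,\dots,\mathbf x_T$. We say that it returns an $\epsilon$-stationary point if $\Phi_{1/2\ell}$ is differentiable and $\mathbb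 E\|\nabla\Phi_{1/2\ell}(\hat{\mathbf x})\|^2\le\epsilon^2$. There is a universal constant $C>0$ such that, with $$K=\frac{\ell(L^2+\sigma^2)\widehat\Delta_\Phi}{\epsilon^{4}},\qquad A=\frac{\ell D^2}{\zeta}\max\Big\{1,\frac{\sigma^2}{\ell\zeta}\Big\},$$ the following hold. 1. For every such max-oracle and every $T$ with $T+1\ge CK$, SGDmax returns an $\epsilon$-stationary point after $T$ iterations. Thus $O(\ell(L^2+\sigma^2)\widehat\Delta_\Phi\epsilon^{-4})$ iterations suffice. 2. For every $\mathbf x$ and every $\mathbf u_0\in\mathcal Y$, let $\mathbf u_{k+1}=\mathcal P_{\mathcal Y}(\mathbf u_k+\eta_{\mathbf y}G_{\mathbf y}(\mathbf x,\mathbf u_k,\xi_k))$ with i.i.d. samples $\xi_k$ (stochastic gradient ascent with batch size $1$). If $N\ge\max\{1,CA\}$, then the average $\bar{\mathbf u}=\frac1N\sum_{k=1}^N\mathbf u_k$ lies in $\mathcal Y$ and satisfies $\mathbb E f(\mathbf x,\bar{\mathbf u})\ge\Phi(\mathbf x)-\zeta$. 3. There are integers $T\ge 0$ and $N\ge 1$,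 with $T\le CK$ and $N\le C\max\{1,A\}$, such that for every $\mathbf u_0\in\mathcal Y$ the following holds. Use as max-oracle $N$ steps of this stochastic gradient ascent, started at $\mathbf u_0$ in every outer iteration, with all samples i.i.d. Then the resulting method is an instance of SGDmax with a $\zeta$-accurate max-oracle, it returns an $\epsilon$-stationary point after $T$ iterations, and the total number of stochastic gradients used is at most $$C\,\frac{\ell(L^2+\sigma^2)\widehat\Delta_\Phi}{\epsilon^4}\max\Big\{1,\ \frac{\ell^2D^2}{\epsilon^2}\max\Big\{1,\frac{\sigma^2}{\epsilon^2}\Big\}\Big\}.$$ In particular, if $\epsilon\le\ell D$, it is at most $$C\,\frac{\ell^3(L^2+\sigma^2)D^2\widehat\Delta_\Phi}{\epsilon^{6}}\max\Big\{1,\frac{\sigma^2}{\epsilon^2}\Big\}.$$ -/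

import Mathlib

open MeasureTheory ProbabilityTheory

noncomputable section

namespace Minimax

/-- `ℝ^d` with the Euclidean norm. -/
abbrev Vec (d : ℕ) : Type := EuclideanSpace ℝ (Fin d)

/-- `ℝ^{m+n} = ℝ^m × ℝ^n` with the Euclidean norm. -/
abbrev Pair (m n : ℕ) : Type := WithLp 2 (Vec m × Vec n)

/-- The point `(x, y)` of `ℝ^{m+n}`. -/
abbrev pair {m n : ℕ} (x : Vec m) (y : Vec n) : Pair m n := WithLp.toLp 2 (x, y)

/-- `f` is `ℓ`-smooth: differentiable with `ℓ`-Lipschitz gradient. -/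
def IsSmooth {m n : ℕ} (ℓ : ℝ) (f : Pair m n → ℝ) : Prop :=
  Differentiable ℝ f ∧ ∀ z z' : Pair m n, ‖gradient f z - gradient f z'‖ ≤ ℓ * ‖z - z'‖

/-- The nonconvex-concave problem class: `f` is `ℓ`-smooth, `f(·, y)` is `L`-Lipschitz for each
`y ∈ Y`, `f(x, ·)` is concave for each `x`, and `Y` is a nonempty, closed, convex and bounded set
of diameter `D`. -/
structure IsNonconvexConcave {m n : ℕ} (f : Pair m n → ℝ) (Y : Set (Vec n)) (ℓ L D : ℝ) :
    Prop where
  smooth : IsSmooth ℓ f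
  lipschitz : ∀ y ∈ Y, ∀ x x' : Vec m, |f (pair x y) - f (pair x' y)| ≤ L * ‖x - x'‖
  concave : ∀ x : Vec m, ConcaveOn ℝ Set.univ (fun y : Vec n => f (pair x y))
  nonempty : Y.Nonempty
  closed : IsClosed Y
  convex : Convex ℝ Y
  bounded : Bornology.IsBounded Y
  diam_eq : Metric.diam Y = D

/-- `G` is an unbiased stochastic gradient oracle for `f` with variance at most `σ²`; the random
seed of the oracle has law `μ`. -/
structure IsStochasticOracle {m n : ℕ} {Ξ : Type*} [MeasurableSpace Ξ] (μ : Measure Ξ)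
    (f : Pair m n → ℝ) (G : Pair m n → Ξ → Pair m n) (σ : ℝ) : Prop where
  measurable : Measurable (fun p : Pair m n × Ξ => G p.1 p.2)
  integrable : ∀ z, Integrable (fun s => G z s - gradient f z) μ
  unbiased : ∀ z, ∫ s, (G z s - gradient f z) ∂μ = 0
  integrable_sq : ∀ z, Integrable (fun s => ‖G z s - gradient f z‖ ^ 2) μ
  variance_le : ∀ z, ∫ s, ‖G z s - gradient f z‖ ^ 2 ∂μ ≤ σ ^ 2

/-- `Φ(x) = max_{y ∈ Y} f(x, y)`. -/
def Phi {m n : ℕ} (f : Pair m n → ℝ) (Y : Set (Vec n)) (x : Vec m) : ℝ :=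
  sSup ((fun y : Vec n => f (pair x y)) '' Y)

/-- The Moreau envelope `φ_lam(x) = min_w φ(w) + ‖w - x‖² / (2 lam)`. -/
def moreauEnvelope {m : ℕ} (lam : ℝ) (φ : Vec m → ℝ) (x : Vec m) : ℝ :=
  ⨅ w : Vec m, (φ w + 1 / (2 * lam) * ‖w - x‖ ^ 2)

/-- `Φ_{1/2ℓ}`. -/
def envelope {m n : ℕ} (f : Pair m n → ℝ) (Y : Set (Vec n)) (ℓ : ℝ) : Vec m → ℝ :=
  moreauEnvelope (1 / (2 * ℓ)) (Phi f Y)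

/-- `Δ̂_Φ = Φ_{1/2ℓ}(x₀) - min_x Φ_{1/2ℓ}(x)`. -/
def envelopeGap {m n : ℕ} (f : Pair m n → ℝ) (Y : Set (Vec n)) (ℓ : ℝ) (x₀ : Vec m) : ℝ :=
  envelope f Y ℓ x₀ - ⨅ x : Vec m, envelope f Y ℓ x

/-- A stochastic method that has generated `x_0, …, x_T` returns an `ε`-stationary point of `Φ`:
`Φ_{1/2ℓ}` is differentiable, and the iterate `x̂` drawn uniformly from `x_0, …, x_T` satisfies
`𝔼 ‖∇Φ_{1/2ℓ}(x̂)‖² ≤ ε²`. -/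
def ReturnsStationary {m n : ℕ} {Ω : Type*} [MeasurableSpace Ω] (P : Measure Ω)
    (f : Pair m n → ℝ) (Y : Set (Vec n)) (ℓ : ℝ) (x : ℕ → Ω → Vec m) (T : ℕ) (ε : ℝ) : Prop :=
  Differentiable ℝ (envelope f Y ℓ) ∧
  (∀ t ≤ T, Integrable (fun ω => ‖gradient (envelope f Y ℓ) (x t ω)‖ ^ 2) P) ∧
  1 / ((T : ℝ) + 1) *
    ∑ t ∈ Finset.range (T + 1), ∫ ω, ‖gradient (envelope f Y ℓ) (x t ω)‖ ^ 2 ∂P ≤ ε ^ 2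

/-- SGDmax with batch size one, step size `ηx` and an arbitrary `ζ`-accurate max-oracle. At step
`t` the oracle supplies a (possibly random) `y_t ∈ Y` with `𝔼[f(x_t, y_t) | x_t] ≥ Φ(x_t) - ζ`, a
fresh sample `ξ_t` of law `μ`, independent of everything generated so far
(`x_0, y_0, ξ_0, …, ξ_{t-1}, x_t, y_t`), is drawn, and
`x_{t+1} = x_t - ηx G_x(x_t, y_t, ξ_t)`. -/
structure IsSGDmaxRun {m n : ℕ} {Ξ Ω : Type*} [MeasurableSpace Ξ] [MeasurableSpace Ω]
    (P : Measure Ω) (μ : Measure Ξ) (f : Pair m n → ℝ) (Y : Set (Vec n))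
    (G : Pair m n → Ξ → Pair m n) (ηx ζ : ℝ) (x₀ : Vec m)
    (x : ℕ → Ω → Vec m) (y : ℕ → Ω → Vec n) (ξ : ℕ → Ω → Ξ) : Prop where
  measurable_x : ∀ t, Measurable (x t)
  measurable_y : ∀ t, Measurable (y t)
  measurable_sample : ∀ t, Measurable (ξ t)
  law_sample : ∀ t, P.map (ξ t) = μ
  fresh : ∀ t, IndepFun (ξ t)
    (fun ω => ((fun s : Fin (t + 1) => (x s ω, y s ω)), (fun s : Fin t => ξ s ω))) P
  init : ∀ ω, x 0 ω = x₀
  mem : ∀ t ω, y t ω ∈ Y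
  oracle : ∀ t, ∀ᵐ ω ∂P, Phi f Y (x t ω) - ζ ≤
    (P[fun ω' => f (pair (x t ω') (y t ω')) | MeasurableSpace.comap (x t) inferInstance]) ω
  step : ∀ t ω, x (t + 1) ω = x t ω - ηx • (G (pair (x t ω) (y t ω)) (ξ t ω)).fst

/-- `(ξ_i)` is a family of i.i.d. samples of law `μ`. -/
structure IsIID {ι Ξ Ω : Type*} [MeasurableSpace Ξ] [MeasurableSpace Ω]
    (P : Measure Ω) (μ : Measure Ξ) (ξ : ι → Ω → Ξ) : Prop where
  measurable : ∀ i, Measurable (ξ i)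
  law : ∀ i, P.map (ξ i) = μ
  indep : iIndepFun ξ P

/-- `p` is a point of `Y` nearest to `z`. -/
def IsNearest {n : ℕ} (Y : Set (Vec n)) (z p : Vec n) : Prop :=
  p ∈ Y ∧ ∀ w ∈ Y, ‖z - p‖ ≤ ‖z - w‖

/-- The Euclidean projection onto `Y` (the nearest point exists and is unique when `Y` is nonempty,
closed and convex). -/
def proj {n : ℕ} (Y : Set (Vec n)) (z : Vec n) : Vec n :=
  Classical.epsilon (IsNearest Y z)

theorem proj_isNearest {n : ℕ} {Y : Set (Vec n)} (hne : Y.Nonempty) (hcl : IsClosed Y)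
    (z : Vec n) : IsNearest Y z (proj Y z) := by
  obtain ⟨p, hp, h⟩ := hcl.exists_infDist_eq_dist hne z
  refine Classical.epsilon_spec (p := IsNearest Y z) ⟨p, hp, fun w hw => ?_⟩
  rw [← dist_eq_norm, ← dist_eq_norm, ← h]
  exact Metric.infDist_le_dist_of_mem hw

/-- State of the inner loop: the current iterate, the sum of the iterates `y_1, …, y_k` and the
number of stochastic gradient evaluations so far. -/
structure SGAState (n : ℕ) where
  y : Vec n
  total : Vec n
  calls : ℕ

/-- `k` steps of projected stochastic gradient ascent with batch size one on `f(x, ·)` over `Y`,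
started at `y₀` and driven by the samples `s 0, s 1, …`:
`y_{k+1} = P_Y(y_k + ηy G_y(x, y_k, s_k))`. -/
def sga {m n : ℕ} {Ξ : Type*} (Y : Set (Vec n)) (G : Pair m n → Ξ → Pair m n) (ηy : ℝ)
    (x : Vec m) (y₀ : Vec n) (s : ℕ → Ξ) : ℕ → SGAState n
  | 0 => ⟨y₀, 0, 0⟩
  | k + 1 =>
    let st := sga Y G ηy x y₀ s k
    let y' := proj Y (st.y + ηy • (G (pair x st.y) (s k)).snd)
    ⟨y', st.total + y', st.calls + 1⟩

/-- The output of `N` steps of stochastic gradient ascent: the average of `y_1, …, y_N`. -/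
def sgaOutput {m n : ℕ} {Ξ : Type*} (Y : Set (Vec n)) (G : Pair m n → Ξ → Pair m n) (ηy : ℝ)
    (x : Vec m) (y₀ : Vec n) (s : ℕ → Ξ) (N : ℕ) : Vec n :=
  (1 / (N : ℝ)) • (sga Y G ηy x y₀ s N).total

/-- State of the outer loop: the current iterate and the total number of stochastic gradient
evaluations so far, those of the inner loops included. -/
structure OuterState (m : ℕ) where
  x : Vec m
  calls : ℕ

/-- `t` iterations of SGDmax with batch size one, whose max-oracle is `N` steps of stochastic
gradient ascent started at `y₀`. Iteration `t` uses the samples `s (t, 0), …, s (t, N - 1)` for the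
inner loop and `s (t, N)` for the update of `x`. -/
def sgdmax {m n : ℕ} {Ξ : Type*} (Y : Set (Vec n)) (G : Pair m n → Ξ → Pair m n) (ηx ηy : ℝ)
    (N : ℕ) (x₀ : Vec m) (y₀ : Vec n) (s : ℕ × ℕ → Ξ) : ℕ → OuterState m
  | 0 => ⟨x₀, 0⟩
  | t + 1 =>
    let st := sgdmax Y G ηx ηy N x₀ y₀ s t
    let y := sgaOutput Y G ηy st.x y₀ (fun k => s (t, k)) N
    ⟨st.x - ηx • (G (pair st.x y) (s (t, N))).fst,
      st.calls + (sga Y G ηy st.x y₀ (fun k => s (t, k)) N).calls + 1⟩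

end Minimax

end

/-! The function `Φ` is a maximum of functions whose `x`-gradient is `ℓ`-Lipschitz, so it is
`ℓ`-weakly convex, and `w ↦ Φ w + ℓ‖w - x‖²` is `ℓ`-strongly convex with a unique minimiser `p =
prox x`. Quadratic growth at `p` (`prox_add_sq_le`) makes `prox` Lipschitz, whence the envelope has
gradient `2ℓ(x - p)`.

Outer loop: testing the envelope at `x - ηg` with the old point `p` costs `2ℓη⟪p - x, g⟫ + ℓη²‖g‖²`.
Up to noise, smoothness and quadratic growth bound the inner product by `Φ x - f (x, y) - ℓ‖p -
x‖²`, whose last term is a multiple of the squared gradient (`envelope_step_le`). In expectation the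
noise vanishes to first order and contributes `σ²` to second order. Telescoping bounds the mean
squared gradient by `2Δ/(η(T+1)) + 4ℓζ + 2ℓη(L² + σ²)`; the parameters make each of the last two
terms `ε²/6`.

Inner loop: projected ascent satisfies the usual one-step inequality for `‖y_k - u‖²`
(`ascent_step_le`). Telescoping and Jensen give the error `D²/(2ηN) + ησ²`, at most `ζ` once `N ≥
2A`. The inner samples of an outer step are independent of `x_t`, so freezing `x_t` turns this into
the conditional guarantee required of a max-oracle (`condExp_comap_eq_of_indepFun`). The gradient
count is then `T(N + 1)`. -/

open scoped RealInnerProductSpace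

noncomputable section

namespace Minimax

/-! ### Quadratic bounds from a Lipschitz gradient. -/

section Smooth

variable {E : Type*} [NormedAddCommGroup E] [InnerProductSpace ℝ E] [CompleteSpace E]

theorem hasDerivAt_comp_line {f : E → ℝ} (hd : Differentiable ℝ f) (z v : E) (t : ℝ) :
    HasDerivAt (fun t : ℝ => f (z + t • v)) ⟪gradient f (z + t • v), v⟫ t := by
  have h1 : HasDerivAt (fun t : ℝ => z + t • v) v t := by
    simpa using ((hasDerivAt_id t).smul_const v).const_add z
  exact ((hd (z + t • v)).hasGradientAt.hasFDerivAt).comp_hasDerivAt t h1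

omit [CompleteSpace E] in
theorem continuous_of_differentiable {f : E → ℝ} (hd : Differentiable ℝ f) : Continuous f :=
  hd.continuous

theorem continuous_gradient_of_lipschitz {f : E → ℝ} {ℓ : ℝ}
    (hl : ∀ z z', ‖gradient f z - gradient f z'‖ ≤ ℓ * ‖z - z'‖) : Continuous (gradient f) := by
  have : LipschitzWith ℓ.toNNReal (gradient f) := LipschitzWith.of_dist_le_mul fun z z' => by
    rw [dist_eq_norm, dist_eq_norm]
    exact (hl z z').trans
      (mul_le_mul_of_nonneg_right (Real.le_coe_toNNReal ℓ) (norm_nonneg _))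
  exact this.continuous

/-- The quadratic upper bound for a function with Lipschitz gradient. -/
theorem le_add_inner_gradient_add_sq {f : E → ℝ} {ℓ : ℝ} (hd : Differentiable ℝ f)
    (hl : ∀ z z', ‖gradient f z - gradient f z'‖ ≤ ℓ * ‖z - z'‖) (z v : E) :
    f (z + v) ≤ f z + ⟪gradient f z, v⟫ + ℓ / 2 * ‖v‖ ^ 2 := by
  have hder : ∀ t : ℝ, HasDerivAt
      (fun t : ℝ => f (z + t • v) - t * ⟪gradient f z, v⟫ - ℓ / 2 * ‖v‖ ^ 2 * t ^ 2)
      (⟪gradient f (z + t • v), v⟫ - ⟪gradient f z, v⟫ - ℓ / 2 * ‖v‖ ^ 2 * (2 * t)) t := by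
    intro t
    have h3 := hasDerivAt_comp_line hd z v t
    have h4 := (h3.sub ((hasDerivAt_id t).mul_const ⟪gradient f z, v⟫)).sub
      ((hasDerivAt_pow 2 t).const_mul (ℓ / 2 * ‖v‖ ^ 2))
    exact h4.congr_deriv (by simp only [one_mul]; norm_num)
  -- The difference between `f` on the ray and the claimed bound has derivative `⟪∇f(z + tv) -
  -- ∇f(z), v⟫ - ℓt‖v‖² ≤ 0` for `t > 0`; the values at `0` and `1` are compared.
  have hanti : AntitoneOn
      (fun t : ℝ => f (z + t • v) - t * ⟪gradient f z, v⟫ - ℓ / 2 * ‖v‖ ^ 2 * t ^ 2)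
      (Set.Ici 0) := by
    refine antitoneOn_of_deriv_nonpos (convex_Ici 0)
      (fun t _ => (hder t).continuousAt.continuousWithinAt)
      (fun t _ => (hder t).differentiableAt.differentiableWithinAt) fun t ht => ?_
    rw [interior_Ici] at ht
    have ht0 : (0 : ℝ) < t := ht
    rw [(hder t).deriv, ← inner_sub_left]
    have h1 := real_inner_le_norm (gradient f (z + t • v) - gradient f z) v
    have h2 := hl (z + t • v) z
    rw [add_sub_cancel_left, norm_smul, Real.norm_of_nonneg ht0.le] at h2
    have h3 := mul_le_mul_of_nonneg_right h2 (norm_nonneg v)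
    nlinarith
  have := hanti (Set.mem_Ici.2 le_rfl) (Set.mem_Ici.2 zero_le_one) zero_le_one
  simp only [one_smul, zero_smul, add_zero] at this
  linarith

theorem gradient_fun_neg {f : E → ℝ} (hd : Differentiable ℝ f) (z : E) :
    gradient (fun w => -f w) z = -gradient f z := by
  have h := (hd z).hasGradientAt
  refine HasGradientAt.gradient ?_
  rw [hasGradientAt_iff_hasFDerivAt] at h ⊢
  rw [map_neg]
  exact h.neg

/-- The quadratic lower bound for a function with Lipschitz gradient. -/
theorem add_inner_gradient_sub_sq_le {f : E → ℝ} {ℓ : ℝ} (hd : Differentiable ℝ f)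
    (hl : ∀ z z', ‖gradient f z - gradient f z'‖ ≤ ℓ * ‖z - z'‖) (z v : E) :
    f z + ⟪gradient f z, v⟫ - ℓ / 2 * ‖v‖ ^ 2 ≤ f (z + v) := by
  have h := le_add_inner_gradient_add_sq (f := fun w => -f w) (ℓ := ℓ) hd.neg (fun z z' => by
    rw [gradient_fun_neg hd, gradient_fun_neg hd, ← neg_sub', norm_neg]
    exact hl z z') z v
  rw [gradient_fun_neg hd, inner_neg_left] at h
  linarith

end Smooth

variable {m n : ℕ} {f : Pair m n → ℝ} {Y : Set (Vec n)} {ℓ L D : ℝ}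

theorem inner_pair_zero_right (g : Pair m n) (v : Vec m) : ⟪g, pair v 0⟫ = ⟪g.fst, v⟫ := by
  simp [WithLp.prod_inner_apply]

theorem inner_pair_zero_left (g : Pair m n) (v : Vec n) : ⟪g, pair 0 v⟫ = ⟪g.snd, v⟫ := by
  simp [WithLp.prod_inner_apply]

theorem norm_sq_pair_zero_right (v : Vec m) : ‖pair v (0 : Vec n)‖ ^ 2 = ‖v‖ ^ 2 := by
  simp

theorem norm_sq_pair_zero_left (v : Vec n) : ‖pair (0 : Vec m) v‖ ^ 2 = ‖v‖ ^ 2 := by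
  simp

theorem pair_add_pair (x x' : Vec m) (y y' : Vec n) :
    pair x y + pair x' y' = pair (x + x') (y + y') := rfl

namespace IsSmooth

theorem continuous (h : IsSmooth ℓ f) : Continuous f :=
  continuous_of_differentiable h.1

theorem continuous_gradient (h : IsSmooth ℓ f) : Continuous (gradient f) :=
  continuous_gradient_of_lipschitz h.2

theorem lower_fst (h : IsSmooth ℓ f) (x x' : Vec m) (y : Vec n) :
    f (pair x y) + ⟪(gradient f (pair x y)).fst, x' - x⟫ - ℓ / 2 * ‖x' - x‖ ^ 2
      ≤ f (pair x' y) := by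
  have := add_inner_gradient_sub_sq_le h.1 h.2 (pair x y) (pair (x' - x) 0)
  rwa [inner_pair_zero_right, norm_sq_pair_zero_right, pair_add_pair, add_sub_cancel,
    add_zero] at this

theorem lower_snd (h : IsSmooth ℓ f) (x : Vec m) (y y' : Vec n) :
    f (pair x y) + ⟪(gradient f (pair x y)).snd, y' - y⟫ - ℓ / 2 * ‖y' - y‖ ^ 2
      ≤ f (pair x y') := by
  have := add_inner_gradient_sub_sq_le h.1 h.2 (pair x y) (pair 0 (y' - y))
  rwa [inner_pair_zero_left, norm_sq_pair_zero_left, pair_add_pair, add_sub_cancel,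
    add_zero] at this

/-- A smooth function is weakly convex in its first argument. -/
theorem weakly_convex_fst (h : IsSmooth ℓ f) (y : Vec n) (x x' : Vec m) {a b : ℝ} (ha : 0 ≤ a)
    (hb : 0 ≤ b) (hab : a + b = 1) :
    f (pair (a • x + b • x') y) ≤
      a * f (pair x y) + b * f (pair x' y) + ℓ / 2 * (a * b) * ‖x - x'‖ ^ 2 := by
  obtain rfl : a = 1 - b := by linarith
  -- Both bounds are based at the intermediate point, so in the weighted sum the gradient terms
  -- cancel and the squares add up to `ab² + ba² = ab`.
  have h1 := h.lower_fst ((1 - b) • x + b • x') x y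
  have h2 := h.lower_fst ((1 - b) • x + b • x') x' y
  have e1 : x - ((1 - b) • x + b • x') = b • (x - x') := by module
  have e2 : x' - ((1 - b) • x + b • x') = -((1 - b) • (x - x')) := by module
  rw [e1, inner_smul_right, norm_smul, Real.norm_of_nonneg hb] at h1
  rw [e2, inner_neg_right, inner_smul_right, norm_neg, norm_smul, Real.norm_of_nonneg ha] at h2
  have h3 := mul_le_mul_of_nonneg_left h1 ha
  have h4 := mul_le_mul_of_nonneg_left h2 hb
  nlinarith

theorem hasDerivAt_snd (h : IsSmooth ℓ f) (x : Vec m) (y v : Vec n) :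
    HasDerivAt (fun t : ℝ => f (pair x (y + t • v))) ⟪(gradient f (pair x y)).snd, v⟫ 0 := by
  have h2 := hasDerivAt_comp_line h.1 (pair x y) (pair 0 v) 0
  have e : ∀ t : ℝ, pair x y + t • pair (0 : Vec m) v = pair x (y + t • v) := fun t => by
    rw [← WithLp.toLp_smul, pair_add_pair]; simp
  simp only [e, zero_smul, add_zero, inner_pair_zero_left] at h2
  exact h2

end IsSmooth

/-! ### Concavity in `y` and the max function `Φ`. -/

namespace IsNonconvexConcave

/-- The gradient inequality for the concave functions `f(x, ·)`. -/
theorem le_add_inner_snd (h : IsNonconvexConcave f Y ℓ L D) (x : Vec m) (y y' : Vec n) :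
    f (pair x y') ≤ f (pair x y) + ⟪(gradient f (pair x y)).snd, y' - y⟫ := by
  have hc : ConcaveOn ℝ Set.univ (fun t : ℝ => f (pair x (y + t • (y' - y)))) := by
    have := (h.concave x).comp_affineMap (AffineMap.lineMap y y' : ℝ →ᵃ[ℝ] Vec n)
    rw [Set.preimage_univ] at this
    refine this.congr fun t _ => ?_
    simp [AffineMap.lineMap_apply, add_comm]
  have hd := h.smooth.hasDerivAt_snd x y (y' - y)
  have := hc.slope_le_of_hasDerivAt (Set.mem_univ 0) (Set.mem_univ 1) zero_lt_one hd
  rw [slope_def_field] at this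
  simp only [one_smul, zero_smul, add_zero, add_sub_cancel] at this
  linarith

theorem isCompact (h : IsNonconvexConcave f Y ℓ L D) : IsCompact Y :=
  Metric.isCompact_of_isClosed_isBounded h.closed h.bounded

theorem exists_isMax (h : IsNonconvexConcave f Y ℓ L D) (x : Vec m) :
    ∃ y ∈ Y, Phi f Y x = f (pair x y) ∧ ∀ y' ∈ Y, f (pair x y') ≤ f (pair x y) := by
  have hc : Continuous (fun y : Vec n => f (pair x y)) :=
    h.smooth.continuous.comp (by fun_prop)
  obtain ⟨y, hy, he, hm⟩ := h.isCompact.exists_sSup_image_eq_and_ge h.nonempty hc.continuousOn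
  exact ⟨y, hy, he, hm⟩

theorem le_Phi (h : IsNonconvexConcave f Y ℓ L D) (x : Vec m) {y : Vec n} (hy : y ∈ Y) :
    f (pair x y) ≤ Phi f Y x := by
  obtain ⟨y', -, he, hm⟩ := h.exists_isMax x
  exact he ▸ hm y hy

theorem Phi_le_add (h : IsNonconvexConcave f Y ℓ L D) (x x' : Vec m) :
    Phi f Y x ≤ Phi f Y x' + L * ‖x - x'‖ := by
  obtain ⟨y, hy, he, -⟩ := h.exists_isMax x
  rw [he]
  linarith [h.le_Phi x' hy, (abs_le.1 (h.lipschitz y hy x x')).2]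

theorem abs_Phi_sub_le (h : IsNonconvexConcave f Y ℓ L D) (x x' : Vec m) :
    |Phi f Y x - Phi f Y x'| ≤ L * ‖x - x'‖ := by
  have h1 := h.Phi_le_add x x'
  have h2 := h.Phi_le_add x' x
  rw [norm_sub_rev] at h2
  exact abs_le.2 ⟨by linarith, by linarith⟩

theorem continuous_Phi (h : IsNonconvexConcave f Y ℓ L D) : Continuous (Phi f Y) := by
  have : LipschitzWith L.toNNReal (Phi f Y) := LipschitzWith.of_dist_le_mul fun z z' => by
    rw [dist_eq_norm, dist_eq_norm]
    exact (h.abs_Phi_sub_le z z').trans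
      (mul_le_mul_of_nonneg_right (Real.le_coe_toNNReal L) (norm_nonneg _))
  exact this.continuous

/-- A maximiser for the intermediate point is kept fixed: `f(·, y)` is weakly convex and lies below
`Φ` at both endpoints. -/
theorem Phi_weakly_convex (h : IsNonconvexConcave f Y ℓ L D) (x x' : Vec m) {a b : ℝ}
    (ha : 0 ≤ a) (hb : 0 ≤ b) (hab : a + b = 1) :
    Phi f Y (a • x + b • x') ≤
      a * Phi f Y x + b * Phi f Y x' + ℓ / 2 * (a * b) * ‖x - x'‖ ^ 2 := by
  obtain ⟨y, hy, he, -⟩ := h.exists_isMax (a • x + b • x')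
  rw [he]
  have h1 := h.smooth.weakly_convex_fst y x x' ha hb hab
  have h2 := mul_le_mul_of_nonneg_left (h.le_Phi x hy) ha
  have h3 := mul_le_mul_of_nonneg_left (h.le_Phi x' hy) hb
  linarith

/-- Moving by `t • g` along the gradient itself raises `f` by at least `t‖g‖² - ℓt²‖g‖²/2` and at
most `Lt‖g‖`. Dividing by `t‖g‖` and letting `t → 0` gives the bound. -/
theorem norm_gradient_fst_le (h : IsNonconvexConcave f Y ℓ L D) (hL : 0 ≤ L) (x : Vec m)
    {y : Vec n} (hy : y ∈ Y) : ‖(gradient f (pair x y)).fst‖ ≤ L := by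
  set g := (gradient f (pair x y)).fst with hg
  by_contra! hlt
  have hg0 : 0 < ‖g‖ := hL.trans_lt hlt
  have key : ∀ t : ℝ, 0 < t → ‖g‖ ≤ L + ℓ / 2 * ‖g‖ * t := fun t ht => by
    have h1 := h.smooth.lower_fst x (x + t • g) y
    have h2 := (abs_le.1 (h.lipschitz y hy (x + t • g) x)).2
    rw [add_sub_cancel_left, ← hg, inner_smul_right, real_inner_self_eq_norm_sq, norm_smul,
      Real.norm_of_nonneg ht.le] at h1
    rw [add_sub_cancel_left, norm_smul, Real.norm_of_nonneg ht.le] at h2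
    have h3 : (t * ‖g‖) * ‖g‖ ≤ (t * ‖g‖) * (L + ℓ / 2 * ‖g‖ * t) := by nlinarith
    exact le_of_mul_le_mul_left h3 (by positivity)
  have hlim : Filter.Tendsto (fun t : ℝ => L + ℓ / 2 * ‖g‖ * t) (nhdsWithin 0 (Set.Ioi 0))
      (nhds L) := by
    have : Continuous (fun t : ℝ => L + ℓ / 2 * ‖g‖ * t) := by fun_prop
    simpa using (this.tendsto 0).mono_left nhdsWithin_le_nhds
  exact hlt.not_ge (ge_of_tendsto hlim (eventually_nhdsWithin_of_forall key))

end IsNonconvexConcave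

/-! ### The proximal point and the Moreau envelope. -/

/-- The proximal point `argmin_w Φ(w) + ℓ ‖w - x‖²`. -/
def prox (f : Pair m n → ℝ) (Y : Set (Vec n)) (ℓ : ℝ) (x : Vec m) : Vec m :=
  Classical.epsilon fun p =>
    ∀ w, Phi f Y p + ℓ * ‖p - x‖ ^ 2 ≤ Phi f Y w + ℓ * ‖w - x‖ ^ 2

theorem envelope_eq_iInf (hℓ : 0 < ℓ) (x : Vec m) :
    envelope f Y ℓ x = ⨅ w : Vec m, (Phi f Y w + ℓ * ‖w - x‖ ^ 2) := by
  have : 1 / (2 * (1 / (2 * ℓ))) = ℓ := by field_simp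
  simp only [envelope, moreauEnvelope, this]

namespace IsNonconvexConcave

/-- A minimiser exists because the objective is continuous and, `Φ` being bounded below, coercive;
this gives the choice in `prox` its meaning. -/
theorem prox_spec (h : IsNonconvexConcave f Y ℓ L D) (hℓ : 0 < ℓ)
    (hb : BddBelow (Set.range (Phi f Y))) (x w : Vec m) :
    Phi f Y (prox f Y ℓ x) + ℓ * ‖prox f Y ℓ x - x‖ ^ 2 ≤ Phi f Y w + ℓ * ‖w - x‖ ^ 2 := by
  obtain ⟨b, hb⟩ := hb
  have hc : Continuous (fun w => Phi f Y w + ℓ * ‖w - x‖ ^ 2) := by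
    have := h.continuous_Phi
    fun_prop
  have ht : Filter.Tendsto (fun w => Phi f Y w + ℓ * ‖w - x‖ ^ 2) (Filter.cocompact (Vec m))
      Filter.atTop := by
    have h1 : Filter.Tendsto (fun w : Vec m => ‖w - x‖) (Filter.cocompact (Vec m))
        Filter.atTop := by
      simpa [dist_eq_norm] using tendsto_dist_right_cocompact_atTop x
    have h2 : Filter.Tendsto (fun w : Vec m => ℓ * ‖w - x‖ ^ 2) (Filter.cocompact (Vec m))
        Filter.atTop :=
      ((Filter.tendsto_pow_atTop two_ne_zero).comp h1).const_mul_atTop hℓ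
    exact Filter.tendsto_atTop_add_left_of_le _ b (fun w => hb ⟨w, rfl⟩) h2
  exact Classical.epsilon_spec (p := fun p => ∀ w, Phi f Y p + ℓ * ‖p - x‖ ^ 2 ≤
    Phi f Y w + ℓ * ‖w - x‖ ^ 2) (hc.exists_forall_le ht) w

theorem bddBelow_prox_objective (hℓ : 0 < ℓ) (hb : BddBelow (Set.range (Phi f Y))) (x : Vec m) :
    BddBelow (Set.range fun w => Phi f Y w + ℓ * ‖w - x‖ ^ 2) := by
  obtain ⟨b, hb⟩ := hb
  refine ⟨b, ?_⟩
  rintro _ ⟨w, rfl⟩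
  have : b ≤ Phi f Y w := hb ⟨w, rfl⟩
  have h2 : 0 ≤ ℓ * ‖w - x‖ ^ 2 := by positivity
  simp only
  linarith

theorem envelope_le (hℓ : 0 < ℓ) (hb : BddBelow (Set.range (Phi f Y))) (x w : Vec m) :
    envelope f Y ℓ x ≤ Phi f Y w + ℓ * ‖w - x‖ ^ 2 := by
  rw [envelope_eq_iInf hℓ]
  exact ciInf_le (bddBelow_prox_objective hℓ hb x) w

theorem envelope_eq (h : IsNonconvexConcave f Y ℓ L D) (hℓ : 0 < ℓ)
    (hb : BddBelow (Set.range (Phi f Y))) (x : Vec m) :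
    envelope f Y ℓ x = Phi f Y (prox f Y ℓ x) + ℓ * ‖prox f Y ℓ x - x‖ ^ 2 := by
  refine (envelope_le hℓ hb x _).antisymm ?_
  rw [envelope_eq_iInf hℓ]
  exact le_ciInf (h.prox_spec hℓ hb x)

theorem bddBelow_envelope (hℓ : 0 < ℓ) (hb : BddBelow (Set.range (Phi f Y))) :
    BddBelow (Set.range (envelope f Y ℓ)) := by
  obtain ⟨b, hb⟩ := hb
  refine ⟨b, ?_⟩
  rintro _ ⟨x, rfl⟩
  rw [envelope_eq_iInf hℓ]
  refine le_ciInf fun w => ?_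
  have : b ≤ Phi f Y w := hb ⟨w, rfl⟩
  have h2 : 0 ≤ ℓ * ‖w - x‖ ^ 2 := by positivity
  linarith

/-- Quadratic growth at the minimiser: the modulus `2ℓ` of the proximal term minus the weak
convexity `ℓ` of `Φ` leaves strong convexity `ℓ`. Minimality is tested at `(1 - b)p + bw`, the
result divided by `b`, and `b → 0`. -/
theorem prox_add_sq_le (h : IsNonconvexConcave f Y ℓ L D) (hℓ : 0 < ℓ)
    (hb : BddBelow (Set.range (Phi f Y))) (x w : Vec m) :
    Phi f Y (prox f Y ℓ x) + ℓ * ‖prox f Y ℓ x - x‖ ^ 2 + ℓ / 2 * ‖prox f Y ℓ x - w‖ ^ 2 ≤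
      Phi f Y w + ℓ * ‖w - x‖ ^ 2 := by
  set p := prox f Y ℓ x
  have key : ∀ b : ℝ, b ∈ Set.Ioo (0 : ℝ) 1 →
      Phi f Y p + ℓ * ‖p - x‖ ^ 2 + ℓ / 2 * (1 - b) * ‖p - w‖ ^ 2 ≤
        Phi f Y w + ℓ * ‖w - x‖ ^ 2 := by
    rintro b ⟨hb0, hb1⟩
    have h1 := h.prox_spec hℓ hb x ((1 - b) • p + b • w)
    have h2 := h.Phi_weakly_convex p w (sub_nonneg.2 hb1.le) hb0.le (sub_add_cancel 1 b)
    have h3 : ‖(1 - b) • p + b • w - x‖ ^ 2 =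
        (1 - b) * ‖p - x‖ ^ 2 + b * ‖w - x‖ ^ 2 - (1 - b) * b * ‖p - w‖ ^ 2 := by
      have e1 : (1 - b) • p + b • w - x = (1 - b) • (p - x) + b • (w - x) := by module
      have e2 : p - w = (p - x) - (w - x) := by module
      rw [e1, e2, norm_add_sq_real, norm_sub_sq_real (p - x) (w - x), norm_smul, norm_smul,
        inner_smul_left, inner_smul_right, Real.norm_of_nonneg hb0.le, Real.norm_of_nonneg (sub_nonneg.2 hb1.le)]
      simp only [conj_trivial]
      ring
    rw [h3] at h1
    have h4 : b * (Phi f Y p + ℓ * ‖p - x‖ ^ 2 + ℓ / 2 * (1 - b) * ‖p - w‖ ^ 2) ≤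
        b * (Phi f Y w + ℓ * ‖w - x‖ ^ 2) := by
      change Phi f Y p + ℓ * ‖p - x‖ ^ 2 ≤ _ at h1
      linarith
    exact le_of_mul_le_mul_left h4 hb0
  have hlim : Filter.Tendsto
      (fun b : ℝ => Phi f Y p + ℓ * ‖p - x‖ ^ 2 + ℓ / 2 * (1 - b) * ‖p - w‖ ^ 2)
      (nhdsWithin 0 (Set.Ioi 0))
      (nhds (Phi f Y p + ℓ * ‖p - x‖ ^ 2 + ℓ / 2 * ‖p - w‖ ^ 2)) := by
    have : Continuous
        (fun b : ℝ => Phi f Y p + ℓ * ‖p - x‖ ^ 2 + ℓ / 2 * (1 - b) * ‖p - w‖ ^ 2) := by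
      fun_prop
    simpa using (this.tendsto 0).mono_left nhdsWithin_le_nhds
  exact le_of_tendsto hlim
    (Filter.mem_of_superset (Ioo_mem_nhdsGT zero_lt_one) key)

/-- Comparison with `w = x` gives `ℓ‖p - x‖² ≤ Φ x - Φ p ≤ L‖p - x‖`. This bound makes the envelope
gradient and the noise cross term integrable. -/
theorem norm_prox_sub_le (h : IsNonconvexConcave f Y ℓ L D) (hℓ : 0 < ℓ) (hL : 0 ≤ L)
    (hb : BddBelow (Set.range (Phi f Y))) (x : Vec m) : ‖prox f Y ℓ x - x‖ ≤ L / ℓ := by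
  have h1 := h.prox_spec hℓ hb x x
  have h2 := h.Phi_le_add x (prox f Y ℓ x)
  rw [sub_self, norm_zero] at h1
  rw [norm_sub_rev] at h2
  rw [le_div_iff₀ hℓ]
  by_contra! hlt
  nlinarith [norm_nonneg (prox f Y ℓ x - x)]

/-- In the sum of the growth inequalities at `x` and `x'` the values of `Φ` cancel, leaving `‖p' -
p‖² ≤ 2⟪p' - p, x' - x⟫`. -/
theorem norm_prox_sub_prox_le (h : IsNonconvexConcave f Y ℓ L D) (hℓ : 0 < ℓ)
    (hb : BddBelow (Set.range (Phi f Y))) (x x' : Vec m) :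
    ‖prox f Y ℓ x' - prox f Y ℓ x‖ ≤ 2 * ‖x' - x‖ := by
  have h1 := h.prox_add_sq_le hℓ hb x (prox f Y ℓ x')
  have h2 := h.prox_add_sq_le hℓ hb x' (prox f Y ℓ x)
  set p := prox f Y ℓ x
  set p' := prox f Y ℓ x'
  have h3 := real_inner_le_norm (p' - p) (x' - x)
  have h4 : ‖p' - x‖ ^ 2 - ‖p - x‖ ^ 2 + ‖p - x'‖ ^ 2 - ‖p' - x'‖ ^ 2
      = 2 * ⟪p' - p, x' - x⟫ := by
    simp only [norm_sub_sq_real, inner_sub_left, inner_sub_right]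
    ring
  rw [norm_sub_rev p p'] at h1
  have h5 : ℓ * ‖p' - p‖ ^ 2 ≤ ℓ * (2 * ⟪p' - p, x' - x⟫) := by rw [← h4]; linarith
  have h6 := le_of_mul_le_mul_left h5 hℓ
  by_contra! hlt
  nlinarith [norm_nonneg (p' - p), norm_nonneg (x' - x)]

/-- Testing the envelope at `x'` with the proximal point of `x` gives a quadratic upper bound.
Exchanging `x` and `x'` gives the lower bound, where the change of `prox` costs `4ℓ‖x' - x‖²` and
`ℓ‖x' - x‖²` is gained back; hence the constant `3ℓ`. -/
theorem hasGradientAt_envelope (h : IsNonconvexConcave f Y ℓ L D) (hℓ : 0 < ℓ)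
    (hb : BddBelow (Set.range (Phi f Y))) (x : Vec m) :
    HasGradientAt (envelope f Y ℓ) ((2 * ℓ) • (x - prox f Y ℓ x)) x := by
  have upper : ∀ x x' : Vec m, envelope f Y ℓ x' ≤ envelope f Y ℓ x +
      2 * ℓ * ⟪x - prox f Y ℓ x, x' - x⟫ + ℓ * ‖x' - x‖ ^ 2 := fun x x' => by
    have h1 := envelope_le hℓ hb x' (prox f Y ℓ x)
    have e : prox f Y ℓ x - x' = -((x - prox f Y ℓ x) + (x' - x)) := by abel
    rw [e, norm_neg, norm_add_sq_real] at h1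
    rw [h.envelope_eq hℓ hb x, norm_sub_rev]
    linarith
  rw [hasGradientAt_iff_isLittleO]
  have hO : (fun x' => envelope f Y ℓ x' - envelope f Y ℓ x -
      ⟪(2 * ℓ) • (x - prox f Y ℓ x), x' - x⟫) =O[nhds x] (fun x' => ‖x' - x‖ ^ 2) := by
    refine Asymptotics.IsBigO.of_bound (3 * ℓ) (Filter.Eventually.of_forall fun x' => ?_)
    rw [inner_smul_left, conj_trivial, Real.norm_eq_abs, norm_pow, norm_norm, abs_le]
    have h1 := upper x x'
    have h2 := upper x' x
    have h3 : ⟪x' - prox f Y ℓ x', x - x'⟫ =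
        ⟪prox f Y ℓ x' - prox f Y ℓ x, x' - x⟫ - ‖x' - x‖ ^ 2
          - ⟪x - prox f Y ℓ x, x' - x⟫ := by
      rw [← real_inner_self_eq_norm_sq, ← neg_sub x' x, inner_neg_right, ← inner_sub_left,
        ← inner_sub_left, ← inner_neg_left]
      congr 1
      abel
    rw [h3, norm_sub_rev x x'] at h2
    have h4 := (real_inner_le_norm (prox f Y ℓ x' - prox f Y ℓ x) (x' - x)).trans
      (mul_le_mul_of_nonneg_right (h.norm_prox_sub_prox_le hℓ hb x x') (norm_nonneg _))
    have h5 := mul_le_mul_of_nonneg_left h4 hℓ.le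
    constructor <;> nlinarith [sq_nonneg ‖x' - x‖]
  exact hO.trans_isLittleO (Asymptotics.isLittleO_pow_sub_sub x one_lt_two)

theorem norm_sq_gradient_envelope (h : IsNonconvexConcave f Y ℓ L D) (hℓ : 0 < ℓ)
    (hb : BddBelow (Set.range (Phi f Y))) (x : Vec m) :
    ‖gradient (envelope f Y ℓ) x‖ ^ 2 = 4 * ℓ ^ 2 * ‖prox f Y ℓ x - x‖ ^ 2 := by
  rw [(h.hasGradientAt_envelope hℓ hb x).gradient, norm_smul, Real.norm_of_nonneg (by positivity),
    norm_sub_rev]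
  ring

theorem continuous_prox (h : IsNonconvexConcave f Y ℓ L D) (hℓ : 0 < ℓ)
    (hb : BddBelow (Set.range (Phi f Y))) : Continuous (prox f Y ℓ) := by
  have : LipschitzWith 2 (prox f Y ℓ) := LipschitzWith.of_dist_le_mul fun z z' => by
    rw [dist_eq_norm, dist_eq_norm]
    exact h.norm_prox_sub_prox_le hℓ hb z' z
  exact this.continuous

/-- One step of the method decreases the envelope up to the error of the oracle. Here `g` is the
stochastic gradient used in the step. -/
theorem envelope_step_le (h : IsNonconvexConcave f Y ℓ L D) (hℓ : 0 < ℓ)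
    (hb : BddBelow (Set.range (Phi f Y))) {η : ℝ} (hη : 0 ≤ η) (x g : Vec m) {y : Vec n}
    (hy : y ∈ Y) :
    envelope f Y ℓ (x - η • g) ≤ envelope f Y ℓ x
      + 2 * ℓ * η * (Phi f Y x - f (pair x y))
      - η / 2 * ‖gradient (envelope f Y ℓ) x‖ ^ 2
      + 2 * ℓ * η * ⟪prox f Y ℓ x - x, g - (gradient f (pair x y)).fst⟫
      + ℓ * η ^ 2 * ‖g‖ ^ 2 := by
  rw [h.norm_sq_gradient_envelope hℓ hb]
  have h1 := envelope_le hℓ hb (x - η • g) (prox f Y ℓ x)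
  have h2 := h.prox_add_sq_le hℓ hb x x
  have h3 := h.smooth.lower_fst x (prox f Y ℓ x) y
  have h4 := h.le_Phi (prox f Y ℓ x) hy
  rw [h.envelope_eq hℓ hb x]
  set p := prox f Y ℓ x
  have e : p - (x - η • g) = (p - x) + η • g := by abel
  rw [e, norm_add_sq_real, inner_smul_right, norm_smul, Real.norm_of_nonneg hη] at h1
  rw [real_inner_comm] at h3
  rw [inner_sub_right]
  rw [sub_self, norm_zero] at h2
  -- Smoothness gives `f(p, y) - f(x, y) + (ℓ/2)‖p - x‖²`; then `f(p, y) ≤ Φ p`, and growth gives `Φ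
  -- p ≤ Φ x - (3ℓ/2)‖p - x‖²`.
  have h5 : ⟪p - x, (gradient f (pair x y)).fst⟫ ≤
      Phi f Y x - f (pair x y) - ℓ * ‖p - x‖ ^ 2 := by nlinarith
  have h6 := mul_le_mul_of_nonneg_left h5 (by positivity : 0 ≤ 2 * ℓ * η)
  nlinarith

end IsNonconvexConcave

variable {σ : ℝ}

/-! ### Moments of the gradient noise at a random point independent of the sample. -/

section Noise

variable {Ξ Ω : Type*} [MeasurableSpace Ξ] [MeasurableSpace Ω] {P : Measure Ω}
  [IsProbabilityMeasure P] {μ : Measure Ξ} {G : Pair m n → Ξ → Pair m n}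
  {z : Ω → Pair m n} {ξ : Ω → Ξ}

namespace IsStochasticOracle

theorem measurable_noise (hG : IsStochasticOracle μ f G σ) (hf : IsSmooth ℓ f) :
    Measurable (fun p : Pair m n × Ξ => G p.1 p.2 - gradient f p.1) :=
  hG.measurable.sub (hf.continuous_gradient.measurable.comp measurable_fst)

theorem map_pair_eq_prod (hz : Measurable z) (hξ : Measurable ξ) (hlaw : P.map ξ = μ)
    (hind : IndepFun ξ z P) : P.map (fun ω => (z ω, ξ ω)) = (P.map z).prod μ := by
  rw [← hlaw]
  exact (indepFun_iff_map_prod_eq_prod_map_map hz.aemeasurable hξ.aemeasurable).1 hind.symm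

theorem integrable_norm_sq_noise_prod [IsProbabilityMeasure μ]
    (hG : IsStochasticOracle μ f G σ) (hf : IsSmooth ℓ f)
    (ν : Measure (Pair m n)) [IsProbabilityMeasure ν] :
    Integrable (fun p : Pair m n × Ξ => ‖G p.1 p.2 - gradient f p.1‖ ^ 2) (ν.prod μ) := by
  have hm : StronglyMeasurable (fun p : Pair m n × Ξ => ‖G p.1 p.2 - gradient f p.1‖ ^ 2) :=
    ((hG.measurable_noise hf).norm.pow_const 2).stronglyMeasurable
  refine (integrable_prod_iff hm.aestronglyMeasurable).2
    ⟨Filter.Eventually.of_forall hG.integrable_sq, ?_⟩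
  refine Integrable.of_bound (C := σ ^ 2) hm.norm.integral_prod_right.aestronglyMeasurable
    (Filter.Eventually.of_forall fun w => ?_)
  rw [Real.norm_of_nonneg (integral_nonneg fun _ => norm_nonneg _)]
  simpa using hG.variance_le w

theorem integrable_norm_sq_noise [IsProbabilityMeasure μ] (hG : IsStochasticOracle μ f G σ)
    (hf : IsSmooth ℓ f) (hz : Measurable z) (hξ : Measurable ξ) (hlaw : P.map ξ = μ)
    (hind : IndepFun ξ z P) :
    Integrable (fun ω => ‖G (z ω) (ξ ω) - gradient f (z ω)‖ ^ 2) P := by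
  have : IsProbabilityMeasure (P.map z) := Measure.isProbabilityMeasure_map hz.aemeasurable
  have h := hG.integrable_norm_sq_noise_prod hf (P.map z)
  rw [← map_pair_eq_prod hz hξ hlaw hind] at h
  exact h.comp_measurable (hz.prodMk hξ)

theorem integral_norm_sq_noise_le [IsProbabilityMeasure μ] (hG : IsStochasticOracle μ f G σ)
    (hf : IsSmooth ℓ f) (hz : Measurable z) (hξ : Measurable ξ) (hlaw : P.map ξ = μ)
    (hind : IndepFun ξ z P) :
    ∫ ω, ‖G (z ω) (ξ ω) - gradient f (z ω)‖ ^ 2 ∂P ≤ σ ^ 2 := by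
  have : IsProbabilityMeasure (P.map z) := Measure.isProbabilityMeasure_map hz.aemeasurable
  have h := hG.integrable_norm_sq_noise_prod hf (P.map z)
  have e := integral_map (μ := P) (hz.prodMk hξ).aemeasurable
    ((hG.measurable_noise hf).norm.pow_const 2).aestronglyMeasurable
  simp only at e
  rw [← e, map_pair_eq_prod hz hξ hlaw hind, integral_prod _ h]
  refine (integral_mono h.integral_prod_left (integrable_const (σ ^ 2)) hG.variance_le).trans ?_
  simp

theorem integrable_norm_noise [IsProbabilityMeasure μ] (hG : IsStochasticOracle μ f G σ)
    (hf : IsSmooth ℓ f) (hz : Measurable z) (hξ : Measurable ξ) (hlaw : P.map ξ = μ)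
    (hind : IndepFun ξ z P) :
    Integrable (fun ω => ‖G (z ω) (ξ ω) - gradient f (z ω)‖) P := by
  refine ((hG.integrable_norm_sq_noise hf hz hξ hlaw hind).add (integrable_const 1)).mono'
    ((hG.measurable_noise hf).comp (hz.prodMk hξ)).norm.aestronglyMeasurable
    (Filter.Eventually.of_forall fun ω => ?_)
  simp only [norm_norm, Pi.add_apply]
  nlinarith [sq_nonneg (‖G (z ω) (ξ ω) - gradient f (z ω)‖ - 1)]

theorem integrable_inner_noise [IsProbabilityMeasure μ] (hG : IsStochasticOracle μ f G σ)
    (hf : IsSmooth ℓ f) (hz : Measurable z) (hξ : Measurable ξ) (hlaw : P.map ξ = μ)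
    (hind : IndepFun ξ z P) {W : Pair m n → Pair m n} (hW : Measurable W) {B : ℝ}
    (hB : ∀ ω, ‖W (z ω)‖ ≤ B) :
    Integrable (fun ω => ⟪W (z ω), G (z ω) (ξ ω) - gradient f (z ω)⟫) P := by
  refine ((hG.integrable_norm_noise hf hz hξ hlaw hind).const_mul B).mono'
    ((hW.comp hz).inner
      ((hG.measurable_noise hf).comp (hz.prodMk hξ))).aestronglyMeasurable
    (Filter.Eventually.of_forall fun ω => ?_)
  exact (abs_real_inner_le_norm _ _).trans
    (mul_le_mul_of_nonneg_right (hB ω) (norm_nonneg _))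

/-- By Fubini under the product law, the integral over the sample comes first, with `z` frozen, and
vanishes by unbiasedness. Boundedness of `W` along `z` supplies integrability. -/
theorem integral_inner_noise [IsProbabilityMeasure μ] (hG : IsStochasticOracle μ f G σ)
    (hf : IsSmooth ℓ f) (hz : Measurable z) (hξ : Measurable ξ) (hlaw : P.map ξ = μ)
    (hind : IndepFun ξ z P) {W : Pair m n → Pair m n} (hW : Measurable W) {B : ℝ}
    (hB : ∀ ω, ‖W (z ω)‖ ≤ B) :
    ∫ ω, ⟪W (z ω), G (z ω) (ξ ω) - gradient f (z ω)⟫ ∂P = 0 := by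
  have : IsProbabilityMeasure (P.map z) := Measure.isProbabilityMeasure_map hz.aemeasurable
  have hm : Measurable (fun p : Pair m n × Ξ => ⟪W p.1, G p.1 p.2 - gradient f p.1⟫) :=
    (hW.comp measurable_fst).inner (hG.measurable_noise hf)
  have hi := hG.integrable_inner_noise hf hz hξ hlaw hind hW hB
  have hi' := (integrable_map_measure (μ := P) hm.aestronglyMeasurable
    (hz.prodMk hξ).aemeasurable).2 hi
  have e := integral_map (μ := P) (hz.prodMk hξ).aemeasurable hm.aestronglyMeasurable
  simp only at e
  rw [map_pair_eq_prod hz hξ hlaw hind] at hi'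
  rw [← e, map_pair_eq_prod hz hξ hlaw hind, integral_prod _ hi']
  refine integral_eq_zero_of_ae (Filter.Eventually.of_forall fun w => ?_)
  simp only [Pi.zero_apply]
  rw [integral_inner (hG.integrable w), hG.unbiased w, inner_zero_right]

end IsStochasticOracle

end Noise

theorem norm_fst_le_norm (z : Pair m n) : ‖z.fst‖ ≤ ‖z‖ := by
  have h := WithLp.prod_norm_sq_eq_of_L2 z
  exact le_of_sq_le_sq (by nlinarith [sq_nonneg ‖z.snd‖]) (norm_nonneg z)

theorem norm_snd_le_norm (z : Pair m n) : ‖z.snd‖ ≤ ‖z‖ := by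
  have h := WithLp.prod_norm_sq_eq_of_L2 z
  exact le_of_sq_le_sq (by nlinarith [sq_nonneg ‖z.fst‖]) (norm_nonneg z)

theorem norm_pair_zero_right (v : Vec m) : ‖pair v (0 : Vec n)‖ = ‖v‖ := by simp

theorem norm_pair_zero_left (v : Vec n) : ‖pair (0 : Vec m) v‖ = ‖v‖ := by simp

namespace IsNonconvexConcave

/-- `f(·, y)` for `y ∈ Y` differs from a constant by at most a Lipschitz term. -/
theorem exists_abs_le (h : IsNonconvexConcave f Y ℓ L D) (x₀ : Vec m) :
    ∃ B, ∀ x, ∀ y ∈ Y, |f (pair x y)| ≤ B + L * ‖x - x₀‖ := by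
  have hc : Continuous (fun y : Vec n => f (pair x₀ y)) :=
    h.smooth.continuous.comp (by fun_prop)
  obtain ⟨B, hB⟩ := h.isCompact.exists_bound_of_continuousOn hc.continuousOn
  refine ⟨B, fun x y hy => ?_⟩
  have h1 := hB y hy
  have h2 := h.lipschitz y hy x x₀
  have h3 := abs_sub_abs_le_abs_sub (f (pair x y)) (f (pair x₀ y))
  rw [Real.norm_eq_abs] at h1
  linarith

theorem envelope_le_Phi (hℓ : 0 < ℓ) (hb : BddBelow (Set.range (Phi f Y))) (x : Vec m) :
    envelope f Y ℓ x ≤ Phi f Y x := by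
  simpa using envelope_le hℓ hb x x

theorem differentiable_envelope (h : IsNonconvexConcave f Y ℓ L D) (hℓ : 0 < ℓ)
    (hb : BddBelow (Set.range (Phi f Y))) : Differentiable ℝ (envelope f Y ℓ) :=
  fun x => (h.hasGradientAt_envelope hℓ hb x).differentiableAt

theorem envelopeGap_nonneg (hℓ : 0 < ℓ) (hb : BddBelow (Set.range (Phi f Y))) (x : Vec m) :
    0 ≤ envelopeGap f Y ℓ x :=
  sub_nonneg.2 (ciInf_le (bddBelow_envelope hℓ hb) x)

theorem exists_abs_envelope_le (h : IsNonconvexConcave f Y ℓ L D) (hℓ : 0 < ℓ)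
    (hb : BddBelow (Set.range (Phi f Y))) (x₀ : Vec m) (hL : 0 ≤ L) :
    ∃ B, ∀ x, |envelope f Y ℓ x| ≤ B + L * ‖x - x₀‖ := by
  obtain ⟨b, hb'⟩ := bddBelow_envelope hℓ hb
  refine ⟨|Phi f Y x₀| + |b|, fun x => abs_le.2 ?_⟩
  have h1 := envelope_le_Phi hℓ hb x
  have h2 := h.Phi_le_add x x₀
  have h3 : b ≤ envelope f Y ℓ x := hb' ⟨x, rfl⟩
  have h4 := neg_abs_le b
  have h5 := le_abs_self (Phi f Y x₀)
  have h6 : 0 ≤ L * ‖x - x₀‖ := by positivity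
  constructor <;> linarith [abs_nonneg b, abs_nonneg (Phi f Y x₀)]

end IsNonconvexConcave

/-- A run of SGDmax without the accuracy of its max-oracle. -/
structure IsSGDRun {m n : ℕ} {Ξ Ω : Type*} [MeasurableSpace Ξ] [MeasurableSpace Ω]
    (P : Measure Ω) (μ : Measure Ξ) (Y : Set (Vec n)) (G : Pair m n → Ξ → Pair m n) (ηx : ℝ)
    (x₀ : Vec m) (x : ℕ → Ω → Vec m) (y : ℕ → Ω → Vec n) (ξ : ℕ → Ω → Ξ) : Prop where
  measurable_x : ∀ t, Measurable (x t)
  measurable_y : ∀ t, Measurable (y t)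
  measurable_sample : ∀ t, Measurable (ξ t)
  law_sample : ∀ t, P.map (ξ t) = μ
  fresh : ∀ t, IndepFun (ξ t)
    (fun ω => ((fun s : Fin (t + 1) => (x s ω, y s ω)), (fun s : Fin t => ξ s ω))) P
  init : ∀ ω, x 0 ω = x₀
  mem : ∀ t ω, y t ω ∈ Y
  step : ∀ t ω, x (t + 1) ω = x t ω - ηx • (G (pair (x t ω) (y t ω)) (ξ t ω)).fst

/-! ### Integrability along a run and the expected descent of the envelope. -/

section Run

variable {Ξ Ω : Type*} [MeasurableSpace Ξ] [MeasurableSpace Ω] {P : Measure Ω}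
  [IsProbabilityMeasure P] {μ : Measure Ξ} [IsProbabilityMeasure μ]
  {G : Pair m n → Ξ → Pair m n} {η ζ : ℝ} {x₀ : Vec m}
  {x : ℕ → Ω → Vec m} {y : ℕ → Ω → Vec n} {ξ : ℕ → Ω → Ξ}

namespace IsSGDRun

omit [IsProbabilityMeasure P] [IsProbabilityMeasure μ] in
theorem indepFun_pair (hr : IsSGDRun P μ Y G η x₀ x y ξ) (t : ℕ) :
    IndepFun (ξ t) (fun ω => pair (x t ω) (y t ω)) P := by
  have hm : Measurable (fun q : (Fin (t + 1) → Vec m × Vec n) × (Fin t → Ξ) =>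
      pair (q.1 (Fin.last t)).1 (q.1 (Fin.last t)).2) := by fun_prop
  exact (hr.fresh t).comp measurable_id hm

omit [IsProbabilityMeasure P] [IsProbabilityMeasure μ] in
theorem measurable_pair (hr : IsSGDRun P μ Y G η x₀ x y ξ) (t : ℕ) :
    Measurable (fun ω => pair (x t ω) (y t ω)) := by
  have h1 := hr.measurable_x t
  have h2 := hr.measurable_y t
  fun_prop

/-- Each step has length at most `|η|(‖noise‖ + L)`. All quantities of linear growth in `x_t` become
integrable through this. -/
theorem integrable_norm_sub (h : IsNonconvexConcave f Y ℓ L D) (hL : 0 ≤ L)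
    (hG : IsStochasticOracle μ f G σ)
    (hr : IsSGDRun P μ Y G η x₀ x y ξ) (t : ℕ) :
    Integrable (fun ω => ‖x t ω - x₀‖) P := by
  induction t with
  | zero => simp [hr.init]
  | succ t ih =>
    have hn := hG.integrable_norm_noise h.smooth (hr.measurable_pair t) (hr.measurable_sample t)
      (hr.law_sample t) (hr.indepFun_pair t)
    refine (ih.add ((hn.add (integrable_const L)).const_mul |η|)).mono'
      ((hr.measurable_x (t + 1)).sub_const x₀).norm.aestronglyMeasurable
      (Filter.Eventually.of_forall fun ω => ?_)
    simp only [norm_norm, Pi.add_apply]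
    set g := G (pair (x t ω) (y t ω)) (ξ t ω)
    set d := gradient f (pair (x t ω) (y t ω)) with hd
    have h1 : ‖g.fst‖ ≤ ‖g - d‖ + L := by
      have h2 : ‖d.fst‖ ≤ L := h.norm_gradient_fst_le hL _ (hr.mem t ω)
      have h3 := norm_fst_le_norm (g - d)
      have h4 := norm_add_le (g - d).fst d.fst
      rw [WithLp.sub_fst, sub_add_cancel] at h4
      rw [WithLp.sub_fst] at h3
      linarith
    rw [hr.step t ω, sub_right_comm]
    refine (norm_sub_le _ _).trans ?_
    rw [norm_smul, Real.norm_eq_abs]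
    exact add_le_add le_rfl (mul_le_mul_of_nonneg_left h1 (abs_nonneg η))

theorem integrable_of_abs_le (h : IsNonconvexConcave f Y ℓ L D) (hL : 0 ≤ L)
    (hG : IsStochasticOracle μ f G σ) (hr : IsSGDRun P μ Y G η x₀ x y ξ) (t : ℕ)
    {F : Ω → ℝ} (hF : Measurable F) {B : ℝ} (hB : ∀ ω, |F ω| ≤ B + L * ‖x t ω - x₀‖) :
    Integrable F P :=
  ((integrable_const B).add ((hr.integrable_norm_sub h hL hG t).const_mul L)).mono'
    hF.aestronglyMeasurable (Filter.Eventually.of_forall hB)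

theorem integrable_value (h : IsNonconvexConcave f Y ℓ L D) (hL : 0 ≤ L)
    (hG : IsStochasticOracle μ f G σ) (hr : IsSGDRun P μ Y G η x₀ x y ξ) (t : ℕ) :
    Integrable (fun ω => f (pair (x t ω) (y t ω))) P := by
  obtain ⟨B, hB⟩ := h.exists_abs_le x₀
  exact hr.integrable_of_abs_le h hL hG t
    (h.smooth.continuous.measurable.comp (hr.measurable_pair t)) fun ω => hB _ _ (hr.mem t ω)

end IsSGDRun

namespace IsSGDmaxRun

omit [IsProbabilityMeasure P] [IsProbabilityMeasure μ] in
theorem isSGDRun (hr : IsSGDmaxRun P μ f Y G η ζ x₀ x y ξ) : IsSGDRun P μ Y G η x₀ x y ξ :=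
  { hr with }

theorem integrable_Phi (h : IsNonconvexConcave f Y ℓ L D) (hL : 0 ≤ L)
    (hG : IsStochasticOracle μ f G σ) (hr : IsSGDmaxRun P μ f Y G η ζ x₀ x y ξ) (t : ℕ) :
    Integrable (fun ω => Phi f Y (x t ω)) P := by
  refine hr.isSGDRun.integrable_of_abs_le h hL hG t (B := |Phi f Y x₀|)
    (h.continuous_Phi.measurable.comp (hr.measurable_x t)) fun ω => ?_
  have h1 := h.abs_Phi_sub_le (x t ω) x₀
  have h2 := abs_sub_abs_le_abs_sub (Phi f Y (x t ω)) (Phi f Y x₀)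
  linarith

theorem integrable_envelope (h : IsNonconvexConcave f Y ℓ L D) (hL : 0 ≤ L) (hℓ : 0 < ℓ)
    (hb : BddBelow (Set.range (Phi f Y)))
    (hG : IsStochasticOracle μ f G σ) (hr : IsSGDmaxRun P μ f Y G η ζ x₀ x y ξ) (t : ℕ) :
    Integrable (fun ω => envelope f Y ℓ (x t ω)) P := by
  obtain ⟨B, hB⟩ := h.exists_abs_envelope_le hℓ hb x₀ hL
  exact hr.isSGDRun.integrable_of_abs_le h hL hG t
    ((h.differentiable_envelope hℓ hb).continuous.measurable.comp (hr.measurable_x t))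
    fun ω => hB _

omit [IsProbabilityMeasure μ] in
theorem integrable_norm_sq_gradient (h : IsNonconvexConcave f Y ℓ L D) (hL : 0 ≤ L) (hℓ : 0 < ℓ)
    (hb : BddBelow (Set.range (Phi f Y)))
    (hr : IsSGDmaxRun P μ f Y G η ζ x₀ x y ξ) (t : ℕ) :
    Integrable (fun ω => ‖gradient (envelope f Y ℓ) (x t ω)‖ ^ 2) P := by
  simp only [h.norm_sq_gradient_envelope hℓ hb]
  have hx := hr.measurable_x t
  have hp := (h.continuous_prox hℓ hb).measurable
  refine Integrable.of_bound (C := 4 * ℓ ^ 2 * (L / ℓ) ^ 2)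
    (by fun_prop : Measurable _).aestronglyMeasurable (Filter.Eventually.of_forall fun ω => ?_)
  rw [Real.norm_of_nonneg (by positivity)]
  gcongr
  exact h.norm_prox_sub_le hℓ hL hb _

theorem integral_Phi_sub_le (h : IsNonconvexConcave f Y ℓ L D) (hL : 0 ≤ L)
    (hG : IsStochasticOracle μ f G σ) (hr : IsSGDmaxRun P μ f Y G η ζ x₀ x y ξ) (t : ℕ) :
    ∫ ω, (Phi f Y (x t ω) - f (pair (x t ω) (y t ω))) ∂P ≤ ζ := by
  have h1 := integral_mono_ae ((hr.integrable_Phi h hL hG t).sub (integrable_const ζ))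
    integrable_condExp (hr.oracle t)
  rw [integral_condExp (hr.measurable_x t).comap_le] at h1
  simp only [Pi.sub_apply] at h1
  rw [integral_sub (hr.integrable_Phi h hL hG t) (integrable_const ζ)] at h1
  rw [integral_sub (hr.integrable_Phi h hL hG t) (hr.isSGDRun.integrable_value h hL hG t)]
  simp only [integral_const, probReal_univ, one_smul] at h1
  linarith

/-- Expected decrease of the envelope in one iteration. -/
theorem integral_envelope_succ_le (h : IsNonconvexConcave f Y ℓ L D) (hL : 0 ≤ L) (hℓ : 0 < ℓ)
    (hη : 0 ≤ η) (hb : BddBelow (Set.range (Phi f Y)))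
    (hG : IsStochasticOracle μ f G σ) (hr : IsSGDmaxRun P μ f Y G η ζ x₀ x y ξ) (t : ℕ) :
    η / 2 * ∫ ω, ‖gradient (envelope f Y ℓ) (x t ω)‖ ^ 2 ∂P ≤
      (∫ ω, envelope f Y ℓ (x t ω) ∂P) - (∫ ω, envelope f Y ℓ (x (t + 1) ω) ∂P)
      + (2 * ℓ * η * ζ + ℓ * η ^ 2 * (L ^ 2 + σ ^ 2)) := by
  let e : Ω → Pair m n := fun ω =>
    G (pair (x t ω) (y t ω)) (ξ t ω) - gradient f (pair (x t ω) (y t ω))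
  -- Both test vectors are functions of `(x_t, y_t)` bounded along the run, so their products with
  -- the noise have mean zero. `W₁` arises from the first-order term, `W₂` from expanding `‖G_x‖²`;
  -- the zero second component selects the `x`-noise.
  let W₁ : Pair m n → Pair m n := fun z => pair (prox f Y ℓ z.fst - z.fst) 0
  let W₂ : Pair m n → Pair m n := fun z => pair (gradient f z).fst 0
  have hW₁ : Measurable W₁ := by
    have := (h.continuous_prox hℓ hb).measurable
    fun_prop
  have hW₂ : Measurable W₂ := by
    have := h.smooth.continuous_gradient.measurable
    fun_prop
  have hB₁ : ∀ ω, ‖W₁ (pair (x t ω) (y t ω))‖ ≤ L / ℓ := fun ω =>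
    (norm_pair_zero_right _).trans_le (h.norm_prox_sub_le hℓ hL hb _)
  have hB₂ : ∀ ω, ‖W₂ (pair (x t ω) (y t ω))‖ ≤ L := fun ω =>
    (norm_pair_zero_right _).trans_le (h.norm_gradient_fst_le hL _ (hr.mem t ω))
  have hz := hr.isSGDRun.measurable_pair t
  have hξ := hr.measurable_sample t
  have hlaw := hr.law_sample t
  have hind := hr.isSGDRun.indepFun_pair t
  have i₁ := hG.integrable_inner_noise h.smooth hz hξ hlaw hind hW₁ hB₁
  have i₂ := hG.integrable_inner_noise h.smooth hz hξ hlaw hind hW₂ hB₂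
  have z₁ := hG.integral_inner_noise h.smooth hz hξ hlaw hind hW₁ hB₁
  have z₂ := hG.integral_inner_noise h.smooth hz hξ hlaw hind hW₂ hB₂
  have i₃ := hG.integrable_norm_sq_noise h.smooth hz hξ hlaw hind
  have z₃ := hG.integral_norm_sq_noise_le h.smooth hz hξ hlaw hind
  have i₄ := (hr.integrable_Phi h hL hG t).sub (hr.isSGDRun.integrable_value h hL hG t)
  have z₄ := hr.integral_Phi_sub_le h hL hG t
  have i₅ := hr.integrable_norm_sq_gradient h hL hℓ hb t
  have i₆ := hr.integrable_envelope h hL hℓ hb hG t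
  have i₇ := hr.integrable_envelope h hL hℓ hb hG (t + 1)
  have hle : ∀ ω, η / 2 * ‖gradient (envelope f Y ℓ) (x t ω)‖ ^ 2 ≤
      envelope f Y ℓ (x t ω) - envelope f Y ℓ (x (t + 1) ω)
      + 2 * ℓ * η * (Phi f Y (x t ω) - f (pair (x t ω) (y t ω)))
      + 2 * ℓ * η * ⟪W₁ (pair (x t ω) (y t ω)), e ω⟫
      + 2 * ℓ * η ^ 2 * ⟪W₂ (pair (x t ω) (y t ω)), e ω⟫
      + ℓ * η ^ 2 * ‖e ω‖ ^ 2 + ℓ * η ^ 2 * L ^ 2 := fun ω => by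
    have h1 := h.envelope_step_le hℓ hb hη (x t ω)
      (G (pair (x t ω) (y t ω)) (ξ t ω)).fst (hr.mem t ω)
    rw [← hr.step t ω] at h1
    have h2 : ⟪W₁ (pair (x t ω) (y t ω)), e ω⟫ = ⟪prox f Y ℓ (x t ω) - x t ω,
        (G (pair (x t ω) (y t ω)) (ξ t ω)).fst - (gradient f (pair (x t ω) (y t ω))).fst⟫ := by
      rw [real_inner_comm, inner_pair_zero_right, real_inner_comm, WithLp.sub_fst]
      rfl
    have h3 : ⟪W₂ (pair (x t ω) (y t ω)), e ω⟫ =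
        ⟪(gradient f (pair (x t ω) (y t ω))).fst, (e ω).fst⟫ := by
      rw [real_inner_comm, inner_pair_zero_right, real_inner_comm]
    have h4 : (G (pair (x t ω) (y t ω)) (ξ t ω)).fst =
        (gradient f (pair (x t ω) (y t ω))).fst + (e ω).fst := by
      rw [WithLp.sub_fst, add_sub_cancel]
    have h5 : ‖(G (pair (x t ω) (y t ω)) (ξ t ω)).fst‖ ^ 2 ≤
        L ^ 2 + 2 * ⟪W₂ (pair (x t ω) (y t ω)), e ω⟫ + ‖e ω‖ ^ 2 := by
      rw [h4, norm_add_sq_real, h3]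
      have h6 := h.norm_gradient_fst_le hL (x t ω) (hr.mem t ω)
      have h7 := norm_fst_le_norm (e ω)
      gcongr
    have h8 := mul_le_mul_of_nonneg_left h5 (by positivity : 0 ≤ ℓ * η ^ 2)
    rw [h2]
    linarith
  have j₁ := (i₆.sub i₇).add (i₄.const_mul (2 * ℓ * η))
  have j₂ := j₁.add (i₁.const_mul (2 * ℓ * η))
  have j₃ := j₂.add (i₂.const_mul (2 * ℓ * η ^ 2))
  have j₄ := j₃.add (i₃.const_mul (ℓ * η ^ 2))
  have j₅ := j₄.add (integrable_const (ℓ * η ^ 2 * L ^ 2))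
  have hint := integral_mono (i₅.const_mul (η / 2)) j₅ hle
  rw [integral_add' j₄ (integrable_const _), integral_add' j₃ (i₃.const_mul _),
    integral_add' j₂ (i₂.const_mul _), integral_add' j₁ (i₁.const_mul _),
    integral_add' (i₆.sub i₇) (i₄.const_mul _), integral_sub' i₆ i₇, integral_const_mul,
    integral_const_mul, integral_const_mul, integral_const_mul, integral_const_mul, z₁, z₂] at hint
  simp only [integral_const, probReal_univ, one_smul, mul_zero, add_zero] at hint
  have k₃ := mul_le_mul_of_nonneg_left z₃ (by positivity : 0 ≤ ℓ * η ^ 2)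
  have k₄ := mul_le_mul_of_nonneg_left z₄ (by positivity : 0 ≤ 2 * ℓ * η)
  simp only [Pi.sub_apply] at hint
  linarith

theorem sum_integral_norm_sq_le (h : IsNonconvexConcave f Y ℓ L D) (hL : 0 ≤ L) (hℓ : 0 < ℓ)
    (hη : 0 ≤ η) (hb : BddBelow (Set.range (Phi f Y)))
    (hG : IsStochasticOracle μ f G σ) (hr : IsSGDmaxRun P μ f Y G η ζ x₀ x y ξ) (T : ℕ) :
    η / 2 * ∑ t ∈ Finset.range T, ∫ ω, ‖gradient (envelope f Y ℓ) (x t ω)‖ ^ 2 ∂P ≤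
      envelopeGap f Y ℓ x₀ + T * (2 * ℓ * η * ζ + ℓ * η ^ 2 * (L ^ 2 + σ ^ 2)) := by
  have h1 : ∀ T : ℕ,
      η / 2 * ∑ t ∈ Finset.range T, ∫ ω, ‖gradient (envelope f Y ℓ) (x t ω)‖ ^ 2 ∂P ≤
      envelope f Y ℓ x₀ - (∫ ω, envelope f Y ℓ (x T ω) ∂P) +
        T * (2 * ℓ * η * ζ + ℓ * η ^ 2 * (L ^ 2 + σ ^ 2)) := by
    intro T
    induction T with
    | zero => simp [hr.init]
    | succ T ih =>
      rw [Finset.sum_range_succ, mul_add]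
      have := hr.integral_envelope_succ_le h hL hℓ hη hb hG T
      push_cast
      linarith
  refine (h1 T).trans ?_
  have h2 : (⨅ x, envelope f Y ℓ x) ≤ ∫ ω, envelope f Y ℓ (x T ω) ∂P := by
    have := integral_mono (integrable_const (⨅ x, envelope f Y ℓ x))
      (hr.integrable_envelope h hL hℓ hb hG T)
      (fun ω => ciInf_le (IsNonconvexConcave.bddBelow_envelope hℓ hb) (x T ω))
    simpa using this
  rw [envelopeGap]
  linarith

/-- Iteration complexity of SGDmax with an arbitrary accurate max-oracle. -/
theorem returnsStationary {ε : ℝ} (h : IsNonconvexConcave f Y ℓ L D) (hL : 0 ≤ L) (hℓ : 0 < ℓ)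
    (hLσ : 0 < L ^ 2 + σ ^ 2) (hε : 0 < ε) (hb : BddBelow (Set.range (Phi f Y)))
    (hG : IsStochasticOracle μ f G σ)
    (hr : IsSGDmaxRun P μ f Y G (ε ^ 2 / (12 * ℓ * (L ^ 2 + σ ^ 2))) (ε ^ 2 / (24 * ℓ)) x₀ x y ξ)
    {T : ℕ} (hT : 36 * (ℓ * (L ^ 2 + σ ^ 2) * envelopeGap f Y ℓ x₀ / ε ^ 4) ≤ (T : ℝ) + 1) :
    ReturnsStationary P f Y ℓ x T ε := by
  refine ⟨h.differentiable_envelope hℓ hb,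
    fun t _ => hr.integrable_norm_sq_gradient h hL hℓ hb t, ?_⟩
  have h1 := hr.sum_integral_norm_sq_le h hL hℓ (by positivity) hb hG (T + 1)
  set S := ∑ t ∈ Finset.range (T + 1), ∫ ω, ‖gradient (envelope f Y ℓ) (x t ω)‖ ^ 2 ∂P
  set M := L ^ 2 + σ ^ 2
  set Δ := envelopeGap f Y ℓ x₀
  have hT0 : (0 : ℝ) < T + 1 := by positivity
  rw [one_div, inv_mul_le_iff₀ hT0]
  have h2 : 2 * ℓ * (ε ^ 2 / (12 * ℓ * M)) * (ε ^ 2 / (24 * ℓ)) +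
      ℓ * (ε ^ 2 / (12 * ℓ * M)) ^ 2 * M = ε ^ 4 / (72 * ℓ * M) := by
    field_simp
    norm_num
  rw [h2] at h1
  push_cast at h1
  have h3 : S = (24 * ℓ * M / ε ^ 2) * (ε ^ 2 / (12 * ℓ * M) / 2 * S) := by
    field_simp
    ring
  -- Multiplication by `2/ηx` isolates the sum. The initial gap then uses two thirds of `(T + 1)ε²`,
  -- which is where `36 = 24 · 3/2` comes from; oracle error and step noise use the remaining third.
  have h4 := mul_le_mul_of_nonneg_left h1 (by positivity : 0 ≤ 24 * ℓ * M / ε ^ 2)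
  rw [← h3] at h4
  have h5 : 24 * ℓ * M / ε ^ 2 * (Δ + (T + 1) * (ε ^ 4 / (72 * ℓ * M))) =
      2 / 3 * ε ^ 2 * (36 * (ℓ * M * Δ / ε ^ 4)) + 1 / 3 * ε ^ 2 * (T + 1) := by
    field_simp
    ring
  rw [h5] at h4
  have h6 := mul_le_mul_of_nonneg_left hT (by positivity : 0 ≤ 2 / 3 * ε ^ 2)
  linarith

end IsSGDmaxRun
end Run

/-! ### Euclidean projection onto `Y`. -/

section Proj

theorem proj_mem (hne : Y.Nonempty) (hcl : IsClosed Y) (z : Vec n) : proj Y z ∈ Y :=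
  (proj_isNearest hne hcl z).1

theorem inner_sub_proj_nonpos (hne : Y.Nonempty) (hcl : IsClosed Y) (hcv : Convex ℝ Y)
    (z : Vec n) {w : Vec n} (hw : w ∈ Y) : ⟪z - proj Y z, w - proj Y z⟫ ≤ 0 := by
  obtain ⟨hp, hmin⟩ := proj_isNearest hne hcl z
  have : Nonempty Y := ⟨⟨_, hp⟩⟩
  refine (norm_eq_iInf_iff_real_inner_le_zero hcv hp).1 (le_antisymm ?_ ?_) w hw
  · exact le_ciInf fun w => hmin w w.2
  · exact ciInf_le ⟨0, Set.forall_mem_range.2 fun _ => norm_nonneg _⟩ (⟨_, hp⟩ : Y)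

/-- Since `proj` is defined by choice, measurability is obtained from nonexpansiveness: the
obtuse-angle inequalities at `a` and `b` are added. -/
theorem measurable_proj (hne : Y.Nonempty) (hcl : IsClosed Y) (hcv : Convex ℝ Y) :
    Measurable (proj Y) := by
  have : LipschitzWith 1 (proj Y) := LipschitzWith.of_dist_le_mul fun a b => by
    rw [dist_eq_norm, dist_eq_norm, NNReal.coe_one, one_mul]
    have h1 := inner_sub_proj_nonpos hne hcl hcv a (proj_mem hne hcl b)
    have h2 := inner_sub_proj_nonpos hne hcl hcv b (proj_mem hne hcl a)
    have h3 : ‖proj Y a - proj Y b‖ ^ 2 ≤ ⟪a - b, proj Y a - proj Y b⟫ := by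
      have e : ⟪a - b, proj Y a - proj Y b⟫ - ‖proj Y a - proj Y b‖ ^ 2 =
          -⟪a - proj Y a, proj Y b - proj Y a⟫ - ⟪b - proj Y b, proj Y a - proj Y b⟫ := by
        rw [← real_inner_self_eq_norm_sq, ← inner_sub_left, ← neg_sub (proj Y a) (proj Y b),
          inner_neg_right, neg_neg, ← inner_sub_left]
        congr 1
        abel
      linarith
    have h4 := real_inner_le_norm (a - b) (proj Y a - proj Y b)
    by_contra! hlt
    nlinarith [norm_nonneg (a - b)]
  exact this.continuous.measurable

end Proj

/-! ### Projected stochastic gradient ascent, pathwise. -/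

section Ascent

variable {Ξ : Type*} {G : Pair m n → Ξ → Pair m n} {η : ℝ} {x : Vec m} {y₀ : Vec n} {s : ℕ → Ξ}

theorem sga_mem (hne : Y.Nonempty) (hcl : IsClosed Y) (hy₀ : y₀ ∈ Y) (k : ℕ) :
    (sga Y G η x y₀ s k).y ∈ Y := by
  cases k with
  | zero => exact hy₀
  | succ k => exact proj_mem hne hcl _

theorem sga_calls (k : ℕ) : (sga Y G η x y₀ s k).calls = k := by
  induction k with
  | zero => rfl
  | succ k ih => exact congrArg (· + 1) ih

theorem sgaOutput_eq_sum (N : ℕ) : sgaOutput Y G η x y₀ s N =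
    ∑ k ∈ Finset.range N, (1 / (N : ℝ)) • (sga Y G η x y₀ s (k + 1)).y := by
  have h : ∀ k, (sga Y G η x y₀ s k).total =
      ∑ j ∈ Finset.range k, (sga Y G η x y₀ s (j + 1)).y := fun k => by
    induction k with
    | zero => rfl
    | succ k ih => rw [Finset.sum_range_succ, ← ih]; rfl
  rw [sgaOutput, h, Finset.smul_sum]

theorem sum_one_div {N : ℕ} (hN : 1 ≤ N) : ∑ _k ∈ Finset.range N, (1 / (N : ℝ)) = 1 := by
  have : (N : ℝ) ≠ 0 := by positivity
  simp [this]

theorem sgaOutput_mem (hne : Y.Nonempty) (hcl : IsClosed Y) (hcv : Convex ℝ Y) (hy₀ : y₀ ∈ Y)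
    {N : ℕ} (hN : 1 ≤ N) : sgaOutput Y G η x y₀ s N ∈ Y := by
  rw [sgaOutput_eq_sum]
  exact hcv.sum_mem (fun _ _ => by positivity) (sum_one_div hN)
    fun k _ => sga_mem hne hcl hy₀ (k + 1)

/-- The σ-algebra is a parameter and only the samples below `N` must be measurable. With the
σ-algebra of the samples already read, the same lemma yields adaptedness, hence independence of
later samples. -/
theorem measurable_sga {Ω : Type*} [MeasurableSpace Ξ] {mΩ : MeasurableSpace Ω}
    (hne : Y.Nonempty) (hcl : IsClosed Y) (hcv : Convex ℝ Y)
    (hG : Measurable (fun p : Pair m n × Ξ => G p.1 p.2)) {X : Ω → Vec m} (hX : Measurable X)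
    {s : Ω → ℕ → Ξ} {N : ℕ} (hs : ∀ j < N, Measurable (fun ω => s ω j)) {k : ℕ} (hk : k ≤ N) :
    Measurable (fun ω => (sga Y G η (X ω) y₀ (s ω) k).y) := by
  induction k with
  | zero => exact measurable_const
  | succ k ih =>
    have h1 := ih (Nat.le_of_succ_le hk)
    have h2 := hs k hk
    have h3 : Measurable (fun ω => G (pair (X ω) (sga Y G η (X ω) y₀ (s ω) k).y) (s ω k)) :=
      hG.comp ((by fun_prop : Measurable
        (fun ω => pair (X ω) (sga Y G η (X ω) y₀ (s ω) k).y)).prodMk h2)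
    exact (measurable_proj hne hcl hcv).comp (by fun_prop)

theorem measurable_sgaOutput {Ω : Type*} [MeasurableSpace Ξ] {mΩ : MeasurableSpace Ω}
    (hne : Y.Nonempty) (hcl : IsClosed Y) (hcv : Convex ℝ Y)
    (hG : Measurable (fun p : Pair m n × Ξ => G p.1 p.2)) {X : Ω → Vec m} (hX : Measurable X)
    {s : Ω → ℕ → Ξ} {N : ℕ} (hs : ∀ j < N, Measurable (fun ω => s ω j)) :
    Measurable (fun ω => sgaOutput Y G η (X ω) y₀ (s ω) N) := by
  simp only [sgaOutput_eq_sum]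
  refine Finset.measurable_sum _ fun k hk => ?_
  have h1 := measurable_sga (η := η) (y₀ := y₀) hne hcl hcv hG hX hs (Finset.mem_range.1 hk)
  exact h1.const_smul (1 / (N : ℝ))

namespace IsNonconvexConcave

/-- One step of projected gradient ascent with the inexact gradient `g`. -/
theorem ascent_step_le (h : IsNonconvexConcave f Y ℓ L D) (hη : 0 < η) (hηℓ : η * ℓ ≤ 1 / 2)
    (x : Vec m) (y g : Vec n) {u : Vec n} (hu : u ∈ Y) :
    2 * η * (f (pair x u) - f (pair x (proj Y (y + η • g)))) ≤
      ‖y - u‖ ^ 2 - ‖proj Y (y + η • g) - u‖ ^ 2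
      + 2 * η * ⟪y - u, g - (gradient f (pair x y)).snd⟫
      + 2 * η ^ 2 * ‖g - (gradient f (pair x y)).snd‖ ^ 2 := by
  have h1 := inner_sub_proj_nonpos h.nonempty h.closed h.convex (y + η • g) hu
  set p := proj Y (y + η • g)
  set d := (gradient f (pair x y)).snd with hd
  have h2 := h.le_add_inner_snd x y u
  have h3 := h.smooth.lower_snd x y p
  rw [← hd] at h2 h3
  set e := g - d with he
  have hg : g = e + d := by rw [he, sub_add_cancel]
  set a := y - u with ha
  set b := p - y with hb
  have e1 : u - y = -a := by rw [ha, neg_sub]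
  have e2 : u - p = -(a + b) := by rw [ha, hb]; abel
  have e3 : p - u = a + b := by rw [ha, hb]; abel
  have e4 : y + η • g - p = η • e + η • d - b := by rw [hg, hb, smul_add]; abel
  rw [e2, e4] at h1
  rw [e1] at h2
  rw [e3, norm_add_sq_real]
  simp only [inner_neg_right, inner_sub_left, inner_add_left, inner_add_right,
    real_inner_smul_left, real_inner_self_eq_norm_sq] at h1 h2
  -- Young's inequality for the noise: `2η⟪e, b⟫ ≤ ‖b‖²/2 + 2η²‖e‖²`. The condition `ηℓ ≤ 1/2`
  -- leaves exactly this `‖b‖²/2` after the smoothness error is paid.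
  have h4 := norm_sub_sq_real b ((2 * η) • e)
  rw [real_inner_smul_right, norm_smul, Real.norm_of_nonneg (by positivity)] at h4
  have h5 := sq_nonneg ‖b - (2 * η) • e‖
  have h6 : η * (f (pair x u) - f (pair x p)) ≤ η * (-⟪d, a⟫ - ⟪d, b⟫ + ℓ / 2 * ‖b‖ ^ 2) :=
    mul_le_mul_of_nonneg_left (by linarith) hη.le
  have h7 : η * ℓ * ‖b‖ ^ 2 ≤ 1 / 2 * ‖b‖ ^ 2 :=
    mul_le_mul_of_nonneg_right hηℓ (sq_nonneg _)
  rw [real_inner_comm a b] at h1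
  rw [real_inner_comm a e, real_inner_comm b e] at h1
  nlinarith

theorem norm_sub_le_diam (h : IsNonconvexConcave f Y ℓ L D) {y u : Vec n} (hy : y ∈ Y)
    (hu : u ∈ Y) : ‖y - u‖ ≤ D := by
  rw [← dist_eq_norm, ← h.diam_eq]
  exact Metric.dist_le_diam_of_mem h.bounded hy hu

end IsNonconvexConcave

end Ascent

/-! ### Independence of functions of disjoint groups of samples. -/

section Independence

variable {Ξ Ω ι α β : Type*} [MeasurableSpace Ξ] [MeasurableSpace Ω] [MeasurableSpace α]
  [MeasurableSpace β] {P : Measure Ω} {μ : Measure Ξ}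

/-- The σ-algebra generated by the samples with index in `S`. -/
abbrev sampleSigma (ξ : ι → Ω → Ξ) (S : Set ι) : MeasurableSpace Ω :=
  ⨆ i ∈ S, MeasurableSpace.comap (ξ i) inferInstance

omit [MeasurableSpace Ω] in
theorem measurable_sampleSigma (ξ : ι → Ω → Ξ) {S : Set ι} {i : ι} (hi : i ∈ S) :
    Measurable[sampleSigma ξ S] (ξ i) :=
  (comap_measurable (ξ i)).mono
    (le_iSup₂ (f := fun i (_ : i ∈ S) => MeasurableSpace.comap (ξ i) inferInstance) i hi) le_rfl

namespace IsIID

/-- Reduces the independence claims below to recording which sample indices each variable reads. -/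
theorem indepFun_of_disjoint {ξ : ι → Ω → Ξ} (hξ : IsIID P μ ξ) {S T : Set ι}
    (hST : Disjoint S T) {U : Ω → α} {V : Ω → β} (hU : Measurable[sampleSigma ξ S] U)
    (hV : Measurable[sampleSigma ξ T] V) : IndepFun U V P := by
  have h1 := indep_iSup_of_disjoint (fun i => (hξ.measurable i).comap_le) hξ.indep.iIndep hST
  rw [IndepFun_iff_Indep]
  exact indep_of_indep_of_le_left (indep_of_indep_of_le_right h1 hV.comap_le) hU.comap_le

end IsIID

end Independence

/-! ### Expected error of stochastic gradient ascent. -/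

section AscentRun

variable {Ξ Ω : Type*} [MeasurableSpace Ξ] [MeasurableSpace Ω] {P : Measure Ω}
  [IsProbabilityMeasure P] {μ : Measure Ξ} [IsProbabilityMeasure μ]
  {G : Pair m n → Ξ → Pair m n} {η : ℝ} {ξ : ℕ → Ω → Ξ}

namespace IsNonconvexConcave

omit [IsProbabilityMeasure μ] in
theorem integrable_value_of_mem (h : IsNonconvexConcave f Y ℓ L D) (x : Vec m) {u : Ω → Vec n}
    (hu : Measurable u) (hm : ∀ ω, u ω ∈ Y) : Integrable (fun ω => f (pair x (u ω))) P := by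
  obtain ⟨B, hB⟩ := h.exists_abs_le x
  refine Integrable.of_bound (C := B) ?_ (Filter.Eventually.of_forall fun ω => ?_)
  · exact (h.smooth.continuous.measurable.comp
      (by fun_prop : Measurable fun ω => pair x (u ω))).aestronglyMeasurable
  · simpa using hB x (u ω) (hm ω)

/-- The `k`-th iterate reads only samples with index below `k`, so the cross term with the noise of
sample `k` has mean zero and only the variance remains. -/
theorem integral_ascent_step_le (h : IsNonconvexConcave f Y ℓ L D)
    (hG : IsStochasticOracle μ f G σ) (hξ : IsIID P μ ξ) (hη : 0 < η) (hηℓ : η * ℓ ≤ 1 / 2)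
    (x : Vec m) {y₀ u : Vec n} (hy₀ : y₀ ∈ Y) (hu : u ∈ Y) (k : ℕ) :
    2 * η * (f (pair x u) -
        ∫ ω, f (pair x (sga Y G η x y₀ (fun k => ξ k ω) (k + 1)).y) ∂P) ≤
      (∫ ω, ‖(sga Y G η x y₀ (fun k => ξ k ω) k).y - u‖ ^ 2 ∂P)
      - (∫ ω, ‖(sga Y G η x y₀ (fun k => ξ k ω) (k + 1)).y - u‖ ^ 2 ∂P)
      + 2 * η ^ 2 * σ ^ 2 := by
  let U : ℕ → Ω → Vec n := fun k ω => (sga Y G η x y₀ (fun k => ξ k ω) k).y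
  have hUm : ∀ k, Measurable (U k) := fun k =>
    measurable_sga h.nonempty h.closed h.convex hG.measurable measurable_const
      (fun j _ => hξ.measurable j) le_rfl
  have hUY : ∀ k ω, U k ω ∈ Y := fun k ω => sga_mem h.nonempty h.closed hy₀ k
  have hz : Measurable (fun ω => pair x (U k ω)) := by
    have := hUm k
    fun_prop
  have hind : IndepFun (ξ k) (fun ω => pair x (U k ω)) P := by
    have h1 : Measurable[sampleSigma ξ (Set.Iio k)] (U k) :=
      measurable_sga (mΩ := sampleSigma ξ (Set.Iio k)) h.nonempty h.closed h.convex hG.measurable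
        measurable_const (fun j hj => measurable_sampleSigma ξ (Set.mem_Iio.2 hj)) le_rfl
    have h2 : IndepFun (ξ k) (U k) P := hξ.indepFun_of_disjoint
      (Set.disjoint_singleton_left.2 Set.self_notMem_Iio)
      (measurable_sampleSigma ξ (Set.mem_singleton k)) h1
    exact h2.comp measurable_id (by fun_prop : Measurable fun w : Vec n => pair x w)
  let W : Pair m n → Pair m n := fun z => pair 0 (z.snd - u)
  have hW : Measurable W := by fun_prop
  have hB : ∀ ω, ‖W (pair x (U k ω))‖ ≤ D := fun ω =>
    (norm_pair_zero_left _).trans_le (h.norm_sub_le_diam (hUY k ω) hu)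
  let e : Ω → Pair m n := fun ω =>
    G (pair x (U k ω)) (ξ k ω) - gradient f (pair x (U k ω))
  have i₁ := hG.integrable_inner_noise h.smooth hz (hξ.measurable k) (hξ.law k) hind hW hB
  have z₁ := hG.integral_inner_noise h.smooth hz (hξ.measurable k) (hξ.law k) hind hW hB
  have i₂ := hG.integrable_norm_sq_noise h.smooth hz (hξ.measurable k) (hξ.law k) hind
  have z₂ := hG.integral_norm_sq_noise_le h.smooth hz (hξ.measurable k) (hξ.law k) hind
  have i₃ : ∀ k, Integrable (fun ω => ‖U k ω - u‖ ^ 2) P := fun k => by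
    have := hUm k
    refine Integrable.of_bound (C := D ^ 2)
      (by fun_prop : Measurable _).aestronglyMeasurable (Filter.Eventually.of_forall fun ω => ?_)
    rw [Real.norm_of_nonneg (by positivity)]
    exact pow_le_pow_left₀ (norm_nonneg _) (h.norm_sub_le_diam (hUY k ω) hu) 2
  have i₄ := h.integrable_value_of_mem (P := P) x (hUm (k + 1)) (hUY (k + 1))
  have hle : ∀ ω, 2 * η * (f (pair x u) - f (pair x (U (k + 1) ω))) ≤
      ‖U k ω - u‖ ^ 2 - ‖U (k + 1) ω - u‖ ^ 2 + 2 * η * ⟪W (pair x (U k ω)), e ω⟫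
        + 2 * η ^ 2 * ‖e ω‖ ^ 2 := fun ω => by
    have h1 := h.ascent_step_le hη hηℓ x (U k ω) (G (pair x (U k ω)) (ξ k ω)).snd hu
    have h2 : ⟪W (pair x (U k ω)), e ω⟫ = ⟪U k ω - u, (e ω).snd⟫ := by
      rw [real_inner_comm, inner_pair_zero_left, real_inner_comm]
      rfl
    rw [h2]
    have h3 : 2 * η ^ 2 * ‖(e ω).snd‖ ^ 2 ≤ 2 * η ^ 2 * ‖e ω‖ ^ 2 := by
      have := norm_snd_le_norm (e ω)
      gcongr
    exact h1.trans (add_le_add le_rfl h3)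
  have j₁ := ((i₃ k).sub (i₃ (k + 1))).add (i₁.const_mul (2 * η))
  have j₂ := j₁.add (i₂.const_mul (2 * η ^ 2))
  have hint := integral_mono (((integrable_const (f (pair x u))).sub i₄).const_mul (2 * η)) j₂ hle
  rw [integral_add' j₁ (i₂.const_mul _), integral_add' ((i₃ k).sub (i₃ (k + 1))) (i₁.const_mul _),
    integral_sub' (i₃ k) (i₃ (k + 1)), integral_const_mul, integral_const_mul, integral_const_mul,
    z₁, integral_sub' (integrable_const _) i₄] at hint
  simp only [integral_const, probReal_univ, one_smul, mul_zero, add_zero] at hint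
  have k₂ := mul_le_mul_of_nonneg_left z₂ (by positivity : 0 ≤ 2 * η ^ 2)
  exact hint.trans (by linarith)

/-- Convergence of projected stochastic gradient ascent. -/
theorem Phi_le_integral_sgaOutput (h : IsNonconvexConcave f Y ℓ L D)
    (hG : IsStochasticOracle μ f G σ) (hξ : IsIID P μ ξ) (hη : 0 < η) (hηℓ : η * ℓ ≤ 1 / 2)
    (x : Vec m) {y₀ : Vec n} (hy₀ : y₀ ∈ Y) {N : ℕ} (hN : 1 ≤ N) :
    Phi f Y x - (D ^ 2 / (2 * η * N) + η * σ ^ 2) ≤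
      ∫ ω, f (pair x (sgaOutput Y G η x y₀ (fun k => ξ k ω) N)) ∂P := by
  obtain ⟨u, hu, he, -⟩ := h.exists_isMax x
  let U : ℕ → Ω → Vec n := fun k ω => (sga Y G η x y₀ (fun k => ξ k ω) k).y
  have hUm : ∀ k, Measurable (U k) := fun k =>
    measurable_sga h.nonempty h.closed h.convex hG.measurable measurable_const
      (fun j _ => hξ.measurable j) le_rfl
  have hUY : ∀ k ω, U k ω ∈ Y := fun k ω => sga_mem h.nonempty h.closed hy₀ k
  have hsum : ∀ N : ℕ,
      2 * η * (N * f (pair x u) - ∑ k ∈ Finset.range N, ∫ ω, f (pair x (U (k + 1) ω)) ∂P) ≤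
      D ^ 2 - (∫ ω, ‖U N ω - u‖ ^ 2 ∂P) + N * (2 * η ^ 2 * σ ^ 2) := fun N => by
    induction N with
    | zero =>
      have h1 := h.norm_sub_le_diam hy₀ hu
      have h2 := pow_le_pow_left₀ (norm_nonneg _) h1 2
      simpa [U, sga] using h2
    | succ N ih =>
      have := h.integral_ascent_step_le hG hξ hη hηℓ x hy₀ hu N
      rw [Finset.sum_range_succ]
      push_cast
      change 2 * η * (f (pair x u) - ∫ ω, f (pair x (U (N + 1) ω)) ∂P) ≤
        (∫ ω, ‖U N ω - u‖ ^ 2 ∂P) - (∫ ω, ‖U (N + 1) ω - u‖ ^ 2 ∂P) + _ at this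
      linarith
  -- Concavity passes the bound on the average value to the value at the average.
  have hjensen : ∀ ω, ∑ k ∈ Finset.range N, (1 / (N : ℝ)) * f (pair x (U (k + 1) ω)) ≤
      f (pair x (sgaOutput Y G η x y₀ (fun k => ξ k ω) N)) := fun ω => by
    rw [sgaOutput_eq_sum]
    exact (h.concave x).le_map_sum (fun _ _ => by positivity) (sum_one_div hN)
      fun _ _ => Set.mem_univ _
  have hi : ∀ k ∈ Finset.range N,
      Integrable (fun ω => (1 / (N : ℝ)) * f (pair x (U (k + 1) ω))) P := fun k _ =>
    (h.integrable_value_of_mem x (hUm (k + 1)) (hUY (k + 1))).const_mul _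
  have hint := integral_mono (integrable_finsetSum _ hi)
    (h.integrable_value_of_mem (P := P) x
      (measurable_sgaOutput h.nonempty h.closed h.convex hG.measurable measurable_const
        fun j _ => hξ.measurable j)
      fun ω => sgaOutput_mem h.nonempty h.closed h.convex hy₀ hN) hjensen
  rw [integral_finsetSum _ hi] at hint
  simp only [integral_const_mul, ← Finset.mul_sum] at hint
  refine le_trans ?_ hint
  have h1 := hsum N
  have h2 : 0 ≤ ∫ ω, ‖U N ω - u‖ ^ 2 ∂P := integral_nonneg fun _ => by positivity
  have hN0 : (0 : ℝ) < N := by positivity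
  rw [he]
  set S := ∑ k ∈ Finset.range N, ∫ ω, f (pair x (U (k + 1) ω)) ∂P
  have h3 : f (pair x u) - (D ^ 2 / (2 * η * N) + η * σ ^ 2) - 1 / N * S =
      (2 * η * (N * f (pair x u) - S) - (D ^ 2 + N * (2 * η ^ 2 * σ ^ 2))) / (2 * η * N) := by
    field_simp
    ring
  have h4 : (2 * η * (N * f (pair x u) - S) - (D ^ 2 + N * (2 * η ^ 2 * σ ^ 2))) / (2 * η * N)
      ≤ 0 := div_nonpos_of_nonpos_of_nonneg (by linarith) (by positivity)
  linarith

end IsNonconvexConcave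

end AscentRun

/-! ### Conditioning on an independent variable. -/

section CondExp

variable {Ω α β : Type*} [MeasurableSpace Ω] [MeasurableSpace α] [MeasurableSpace β]
  {P : Measure Ω} [IsProbabilityMeasure P]

/-- The conditional expectation of `F (X, S)` given `X` when `S` is independent of `X`. -/
theorem condExp_comap_eq_of_indepFun {X : Ω → α} {S : Ω → β} (hX : Measurable X)
    (hS : Measurable S) (hind : IndepFun X S P) {F : α × β → ℝ} (hF : Measurable F)
    (hi : Integrable (fun ω => F (X ω, S ω)) P) :
    (fun ω => ∫ ω', F (X ω, S ω') ∂P) =ᵐ[P]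
      P[fun ω => F (X ω, S ω) | MeasurableSpace.comap X inferInstance] := by
  have : IsProbabilityMeasure (P.map X) := Measure.isProbabilityMeasure_map hX.aemeasurable
  have : IsProbabilityMeasure (P.map S) := Measure.isProbabilityMeasure_map hS.aemeasurable
  have hprod := (indepFun_iff_map_prod_eq_prod_map_map hX.aemeasurable hS.aemeasurable).1 hind
  have hi' : Integrable F ((P.map X).prod (P.map S)) := by
    rw [← hprod]
    exact (integrable_map_measure hF.aestronglyMeasurable (hX.prodMk hS).aemeasurable).2 hi
  have e : ∀ a, ∫ ω', F (a, S ω') ∂P = ∫ b, F (a, b) ∂(P.map S) := fun a =>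
    (integral_map hS.aemeasurable
      (hF.comp measurable_prodMk_left).aestronglyMeasurable).symm
  simp only [e]
  have hψ : StronglyMeasurable (fun a => ∫ b, F (a, b) ∂(P.map S)) :=
    hF.stronglyMeasurable.integral_prod_right'
  have hψi : Integrable (fun ω => ∫ b, F (X ω, b) ∂(P.map S)) P :=
    hi'.integral_prod_left.comp_measurable hX
  refine ae_eq_condExp_of_forall_setIntegral_eq hX.comap_le hi (fun _ _ _ => hψi.integrableOn)
    ?_ (hψ.comp_measurable (comap_measurable X)).aestronglyMeasurable
  -- On a set `X⁻¹(B)` both sides equal the integral of `F` over `B × univ` under the product law,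
  -- by Fubini.
  rintro _ ⟨B, hB, rfl⟩ -
  have h1 := setIntegral_map (μ := P) (g := X) hB hψ.aestronglyMeasurable hX.aemeasurable
  have h2 := setIntegral_map (μ := P) (g := fun ω => (X ω, S ω))
    (hB.prod (MeasurableSet.univ (α := β))) hF.aestronglyMeasurable (hX.prodMk hS).aemeasurable
  rw [hprod, setIntegral_prod _ hi'.integrableOn] at h2
  simp only [Measure.restrict_univ] at h2
  rw [← h1, h2]
  congr 2
  ext ω
  simp

end CondExp

/-! ### Ascent step size and accuracy of the oracle. -/

section StepSize

variable {ζ η : ℝ}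

/-- The last bound reflects `1/η = 2ℓ max{1, σ²/(ℓζ)}`. The case `σ = 0` is separate because `ζ / (2
* σ ^ 2)` is then `0` by convention, and the minimum would vanish. -/
theorem stepSize_bounds (hℓ : 0 < ℓ) (hζ : 0 < ζ)
    (hη : η = if σ = 0 then 1 / (2 * ℓ) else min (1 / (2 * ℓ)) (ζ / (2 * σ ^ 2))) :
    0 < η ∧ η * ℓ ≤ 1 / 2 ∧ η * σ ^ 2 ≤ ζ / 2 ∧
      1 ≤ 2 * η * (ℓ * max 1 (σ ^ 2 / (ℓ * ζ))) := by
  have hmax : ℓ ≤ ℓ * max 1 (σ ^ 2 / (ℓ * ζ)) := le_mul_of_one_le_right hℓ.le (le_max_left _ _)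
  have hbase : 1 / (2 * ℓ) * ℓ = 1 / 2 := by field_simp
  have hpos : 0 < 1 / (2 * ℓ) := by positivity
  split_ifs at hη with hσ
  · subst hη hσ
    refine ⟨hpos, hbase.le, ?_, by nlinarith⟩
    rw [zero_pow two_ne_zero, mul_zero]
    exact (half_pos hζ).le
  · have hσ2 : 0 < σ ^ 2 := by positivity
    have hζσ : ζ / (2 * σ ^ 2) * σ ^ 2 = ζ / 2 := by field_simp
    subst hη
    refine ⟨lt_min hpos (by positivity), ?_, ?_, ?_⟩
    · exact (mul_le_mul_of_nonneg_right (min_le_left _ _) hℓ.le).trans_eq hbase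
    · exact (mul_le_mul_of_nonneg_right (min_le_right _ _) hσ2.le).trans_eq hζσ
    · rcases min_choice (1 / (2 * ℓ)) (ζ / (2 * σ ^ 2)) with h | h <;> rw [h]
      · nlinarith
      · have h1 : σ ^ 2 / ζ ≤ ℓ * max 1 (σ ^ 2 / (ℓ * ζ)) := by
          have h2 : σ ^ 2 / ζ = ℓ * (σ ^ 2 / (ℓ * ζ)) := by field_simp
          rw [h2]
          exact mul_le_mul_of_nonneg_left (le_max_right _ _) hℓ.le
        refine le_trans (le_of_eq ?_) (mul_le_mul_of_nonneg_left h1 (by positivity))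
        field_simp

end StepSize

section Oracle

variable {Ξ Ω : Type*} [MeasurableSpace Ξ] [MeasurableSpace Ω] {P : Measure Ω}
  [IsProbabilityMeasure P] {μ : Measure Ξ} [IsProbabilityMeasure μ]
  {G : Pair m n → Ξ → Pair m n} {ζ η : ℝ}

/-- Stochastic gradient ascent is an accurate max-oracle. -/
theorem IsNonconvexConcave.Phi_sub_le_integral_sgaOutput (h : IsNonconvexConcave f Y ℓ L D)
    (hℓ : 0 < ℓ) (hζ : 0 < ζ)
    (hη : η = if σ = 0 then 1 / (2 * ℓ) else min (1 / (2 * ℓ)) (ζ / (2 * σ ^ 2)))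
    (hG : IsStochasticOracle μ f G σ) {ξ : ℕ → Ω → Ξ} (hξ : IsIID P μ ξ)
    (x : Vec m) {y₀ : Vec n} (hy₀ : y₀ ∈ Y) {N : ℕ} (hN : 1 ≤ N)
    (hNA : 2 * (ℓ * D ^ 2 / ζ * max 1 (σ ^ 2 / (ℓ * ζ))) ≤ N) :
    Phi f Y x - ζ ≤ ∫ ω, f (pair x (sgaOutput Y G η x y₀ (fun k => ξ k ω) N)) ∂P := by
  obtain ⟨h1, h2, h3, h4⟩ := stepSize_bounds hℓ hζ hη
  refine le_trans ?_ (h.Phi_le_integral_sgaOutput hG hξ h1 h2 x hy₀ hN)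
  have hN0 : (0 : ℝ) < N := by positivity
  -- The error budget `ζ` is split evenly between the initial distance and the noise `ησ²`.
  have h5 : D ^ 2 / (2 * η * N) ≤ ζ / 2 := by
    rw [div_le_iff₀ (by positivity)]
    have h6 := mul_le_mul_of_nonneg_left hNA (by positivity : 0 ≤ η * ζ)
    have h7 : η * ζ * (2 * (ℓ * D ^ 2 / ζ * max 1 (σ ^ 2 / (ℓ * ζ)))) =
        D ^ 2 * (2 * η * (ℓ * max 1 (σ ^ 2 / (ℓ * ζ)))) := by
      field_simp
    rw [h7] at h6
    have h8 := le_mul_of_one_le_right (sq_nonneg D) h4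
    linarith
  linarith

end Oracle

/-! ### SGDmax driven by stochastic gradient ascent. -/

section Outer

variable {Ξ Ω : Type*} [MeasurableSpace Ξ] {G : Pair m n → Ξ → Pair m n} {ηx ηy ζ : ℝ} {N : ℕ}
  {x₀ : Vec m} {y₀ : Vec n}

omit [MeasurableSpace Ξ] in
theorem sgdmax_calls (s : ℕ × ℕ → Ξ) (t : ℕ) :
    (sgdmax Y G ηx ηy N x₀ y₀ s t).calls = t * (N + 1) := by
  induction t with
  | zero => simp [sgdmax]
  | succ t ih => simp only [sgdmax, sga_calls, ih]; ring

theorem measurable_sgdmax {mΩ : MeasurableSpace Ω} (hne : Y.Nonempty) (hcl : IsClosed Y)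
    (hcv : Convex ℝ Y) (hG : Measurable (fun p : Pair m n × Ξ => G p.1 p.2))
    {ξ : ℕ × ℕ → Ω → Ξ} {t : ℕ} (hξ : ∀ i : ℕ × ℕ, i.1 < t → Measurable (ξ i)) :
    Measurable (fun ω => (sgdmax Y G ηx ηy N x₀ y₀ (fun i => ξ i ω) t).x) := by
  induction t with
  | zero => exact measurable_const
  | succ t ih =>
    have h1 := ih fun i hi => hξ i (hi.trans t.lt_succ_self)
    have h2 : Measurable (fun ω => sgaOutput Y G ηy
        (sgdmax Y G ηx ηy N x₀ y₀ (fun i => ξ i ω) t).x y₀ (fun k => ξ (t, k) ω) N) :=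
      measurable_sgaOutput hne hcl hcv hG h1 fun j _ => hξ (t, j) t.lt_succ_self
    have h3 := hG.comp ((by fun_prop : Measurable (fun ω => pair
        (sgdmax Y G ηx ηy N x₀ y₀ (fun i => ξ i ω) t).x (sgaOutput Y G ηy
        (sgdmax Y G ηx ηy N x₀ y₀ (fun i => ξ i ω) t).x y₀ (fun k => ξ (t, k) ω) N))).prodMk
      (hξ (t, N) t.lt_succ_self))
    have h4 : Measurable (fun z : Pair m n => z.fst) := by fun_prop
    exact h1.sub ((h4.comp h3).const_smul ηx)

variable [MeasurableSpace Ω] {P : Measure Ω} [IsProbabilityMeasure P] {μ : Measure Ξ}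
  [IsProbabilityMeasure μ]

omit [IsProbabilityMeasure P] [IsProbabilityMeasure μ] in
theorem indepFun_sgdmax_history (h : IsNonconvexConcave f Y ℓ L D)
    (hG : IsStochasticOracle μ f G σ) {ξ : ℕ × ℕ → Ω → Ξ} (hξ : IsIID P μ ξ) (t : ℕ) :
    IndepFun (ξ (t, N)) (fun ω =>
      ((fun s : Fin (t + 1) => ((sgdmax Y G ηx ηy N x₀ y₀ (fun i => ξ i ω) s).x,
        sgaOutput Y G ηy (sgdmax Y G ηx ηy N x₀ y₀ (fun i => ξ i ω) s).x y₀
          (fun k => ξ (s, k) ω) N)),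
        (fun s : Fin t => ξ (s, N) ω))) P := by
  -- These indices cover all samples read before the update of iteration `t`: the earlier rows and
  -- the inner samples of row `t`, but not `(t, N)`.
  let S : Set (ℕ × ℕ) := {i | i.1 < t ∨ i.1 = t ∧ i.2 < N}
  refine hξ.indepFun_of_disjoint (T := S) (Set.disjoint_singleton_left.2 ?_)
    (measurable_sampleSigma ξ (Set.mem_singleton (t, N))) ?_
  · rintro (h1 | ⟨-, h1⟩)
    · exact lt_irrefl t h1
    · exact lt_irrefl N h1
  let mS : MeasurableSpace Ω := sampleSigma ξ S
  have hx : ∀ s ≤ t, Measurable[mS]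
      (fun ω => (sgdmax Y G ηx ηy N x₀ y₀ (fun i => ξ i ω) s).x) := fun s hs =>
    measurable_sgdmax (mΩ := mS) h.nonempty h.closed h.convex hG.measurable
      fun i hi => measurable_sampleSigma ξ (Or.inl (hi.trans_le hs))
  refine Measurable.prodMk (measurable_pi_lambda _ fun s => ?_) (measurable_pi_lambda _ fun s =>
    measurable_sampleSigma ξ (i := ((s : ℕ), N)) (Or.inl s.2))
  have hs : (s : ℕ) ≤ t := Nat.lt_succ_iff.1 s.2
  refine (hx s hs).prodMk (measurable_sgaOutput (mΩ := mS) h.nonempty h.closed h.convex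
    hG.measurable (hx s hs) fun j hj => measurable_sampleSigma ξ (i := ((s : ℕ), j)) ?_)
  rcases hs.lt_or_eq with h1 | h1
  · exact Or.inl h1
  · exact Or.inr ⟨h1, hj⟩

/-- SGDmax with stochastic gradient ascent as its max-oracle is a run of SGDmax. -/
theorem isSGDmaxRun_sgdmax (h : IsNonconvexConcave f Y ℓ L D) (hL : 0 ≤ L)
    (hℓ : 0 < ℓ) (hζ : 0 < ζ)
    (hη : ηy = if σ = 0 then 1 / (2 * ℓ) else min (1 / (2 * ℓ)) (ζ / (2 * σ ^ 2)))
    (hG : IsStochasticOracle μ f G σ) {ξ : ℕ × ℕ → Ω → Ξ} (hξ : IsIID P μ ξ)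
    (hy₀ : y₀ ∈ Y) (hN : 1 ≤ N)
    (hNA : 2 * (ℓ * D ^ 2 / ζ * max 1 (σ ^ 2 / (ℓ * ζ))) ≤ N) :
    IsSGDmaxRun P μ f Y G ηx ζ x₀
      (fun t ω => (sgdmax Y G ηx ηy N x₀ y₀ (fun i => ξ i ω) t).x)
      (fun t ω => sgaOutput Y G ηy
        (sgdmax Y G ηx ηy N x₀ y₀ (fun i => ξ i ω) t).x y₀ (fun k => ξ (t, k) ω) N)
      (fun t ω => ξ (t, N) ω) := by
  have hx : ∀ t, Measurable (fun ω => (sgdmax Y G ηx ηy N x₀ y₀ (fun i => ξ i ω) t).x) :=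
    fun t => measurable_sgdmax h.nonempty h.closed h.convex hG.measurable
      fun i _ => hξ.measurable i
  -- The run is built without oracle accuracy because its integrability is needed to identify the
  -- conditional expectation that proves the accuracy.
  have hr : IsSGDRun P μ Y G ηx x₀
      (fun t ω => (sgdmax Y G ηx ηy N x₀ y₀ (fun i => ξ i ω) t).x)
      (fun t ω => sgaOutput Y G ηy
        (sgdmax Y G ηx ηy N x₀ y₀ (fun i => ξ i ω) t).x y₀ (fun k => ξ (t, k) ω) N)
      (fun t ω => ξ (t, N) ω) :=
    { measurable_x := hx
      measurable_y := fun t => measurable_sgaOutput h.nonempty h.closed h.convex hG.measurable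
        (hx t) fun j _ => hξ.measurable (t, j)
      measurable_sample := fun t => hξ.measurable (t, N)
      law_sample := fun t => hξ.law (t, N)
      fresh := fun t => indepFun_sgdmax_history h hG hξ t
      init := fun ω => rfl
      mem := fun t ω => sgaOutput_mem h.nonempty h.closed h.convex hy₀ hN
      step := fun t ω => rfl }
  refine { hr with oracle := fun t => ?_ }
  have hrow : IsIID P μ (fun k => ξ (t, k)) :=
    ⟨fun k => hξ.measurable (t, k), fun k => hξ.law (t, k),
      hξ.indep.precomp (Prod.mk_right_injective t)⟩
  -- The iterate `x_t` reads only rows before `t`, whereas the inner loop reads row `t`.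
  have hind : IndepFun (fun ω => (sgdmax Y G ηx ηy N x₀ y₀ (fun i => ξ i ω) t).x)
      (fun ω k => ξ (t, k) ω) P := by
    refine hξ.indepFun_of_disjoint (S := {i | i.1 < t}) (T := {i | i.1 = t})
      (Set.disjoint_left.2 fun i hi hi' => (ne_of_lt hi) hi') ?_ ?_
    · exact measurable_sgdmax (mΩ := sampleSigma ξ {i | i.1 < t}) h.nonempty h.closed h.convex
        hG.measurable fun i hi => measurable_sampleSigma ξ hi
    · exact @measurable_pi_lambda _ _ _ (sampleSigma ξ {i | i.1 = t}) _ _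
        fun k => measurable_sampleSigma ξ (i := (t, k)) rfl
  have hF : Measurable (fun p : Vec m × (ℕ → Ξ) =>
      f (pair p.1 (sgaOutput Y G ηy p.1 y₀ p.2 N))) := by
    have h1 : Measurable (fun p : Vec m × (ℕ → Ξ) => sgaOutput Y G ηy p.1 y₀ p.2 N) :=
      measurable_sgaOutput h.nonempty h.closed h.convex hG.measurable measurable_fst
        fun j _ => (measurable_pi_apply j).comp measurable_snd
    exact h.smooth.continuous.measurable.comp (by fun_prop : Measurable
      (fun p : Vec m × (ℕ → Ξ) => pair p.1 (sgaOutput Y G ηy p.1 y₀ p.2 N)))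
  have hc := condExp_comap_eq_of_indepFun (hx t)
    (measurable_pi_lambda _ fun k => hξ.measurable (t, k)) hind hF
    (hr.integrable_value h hL hG t)
  filter_upwards [hc] with ω hω
  refine le_of_le_of_eq ?_ hω
  exact h.Phi_sub_le_integral_sgaOutput hℓ hζ hη hG hrow _ hy₀ hN hNA

end Outer

/-! ### Counting stochastic gradients. -/

/-- The number of samples of the inner loop in terms of the accuracy `ε`. -/
theorem max_one_innerComplexity_le {ℓ D σ ε : ℝ} (hℓ : 0 < ℓ) (hε : 0 < ε) :
    max 1 (ℓ * D ^ 2 / (ε ^ 2 / (24 * ℓ)) * max 1 (σ ^ 2 / (ℓ * (ε ^ 2 / (24 * ℓ))))) ≤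
      576 * max 1 (ℓ ^ 2 * D ^ 2 / ε ^ 2 * max 1 (σ ^ 2 / ε ^ 2)) := by
  have h1 : ℓ * D ^ 2 / (ε ^ 2 / (24 * ℓ)) = 24 * (ℓ ^ 2 * D ^ 2 / ε ^ 2) := by field_simp
  have h2 : σ ^ 2 / (ℓ * (ε ^ 2 / (24 * ℓ))) = 24 * (σ ^ 2 / ε ^ 2) := by field_simp
  rw [h1, h2]
  have h3 : max 1 (24 * (σ ^ 2 / ε ^ 2)) ≤ 24 * max 1 (σ ^ 2 / ε ^ 2) :=
    max_le (by linarith [le_max_left 1 (σ ^ 2 / ε ^ 2)])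
      (mul_le_mul_of_nonneg_left (le_max_right _ _) (by norm_num))
  have h4 : 0 ≤ ℓ ^ 2 * D ^ 2 / ε ^ 2 := by positivity
  set B := ℓ ^ 2 * D ^ 2 / ε ^ 2
  set M := max 1 (σ ^ 2 / ε ^ 2)
  refine max_le (by linarith [le_max_left 1 (B * M)]) ?_
  have h5 := mul_le_mul_of_nonneg_left h3 (by positivity : 0 ≤ 24 * B)
  linarith [le_max_right 1 (B * M)]

/-- The total number of stochastic gradients of `T` outer iterations. -/
theorem totalCalls_le {K A B : ℝ} {T N : ℕ} (hK : 0 ≤ K) (hT : (T : ℝ) ≤ 36 * K)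
    (hN : (N : ℝ) ≤ 3 * max 1 A) (hAB : max 1 A ≤ 576 * max 1 B) :
    ((T * (N + 1) : ℕ) : ℝ) ≤ 100000 * (K * max 1 B) := by
  -- `N + 1 ≤ 4 max 1 A` and `4 · 576 = 2304`; finally `36 · 2304 = 82944 ≤ 100000`.
  have h1 : (N : ℝ) + 1 ≤ 2304 * max 1 B := by linarith [le_max_left 1 A]
  push_cast
  have h2 := mul_le_mul hT h1 (by positivity) (by positivity)
  have h3 : 0 ≤ K * max 1 B := mul_nonneg hK (zero_le_one.trans (le_max_left _ _))
  linarith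

end Minimax

end

theorem mainTheorem10 :
    ∃ C : ℝ, 0 < C ∧
      ∀ (m n : ℕ) (f : Minimax.Pair m n → ℝ) (Y : Set (Minimax.Vec n)) (ℓ L D σ ε : ℝ)
        (Ξ : Type*) [MeasurableSpace Ξ] (μ : Measure Ξ) [IsProbabilityMeasure μ]
        (G : Minimax.Pair m n → Ξ → Minimax.Pair m n) (x₀ : Minimax.Vec m),
        0 < ℓ → 0 ≤ L → 0 ≤ σ → 0 < L ^ 2 + σ ^ 2 → 0 < ε →
        Minimax.IsNonconvexConcave f Y ℓ L D →
        Minimax.IsStochasticOracle μ f G σ →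
        BddBelow (Set.range (Minimax.Phi f Y)) →
        ∀ (ζ ηx ηy K A : ℝ),
          ζ = ε ^ 2 / (24 * ℓ) →
          ηx = ε ^ 2 / (12 * ℓ * (L ^ 2 + σ ^ 2)) →
          ηy = (if σ = 0 then 1 / (2 * ℓ) else min (1 / (2 * ℓ)) (ζ / (2 * σ ^ 2))) →
          K = ℓ * (L ^ 2 + σ ^ 2) * Minimax.envelopeGap f Y ℓ x₀ / ε ^ 4 →
          A = ℓ * D ^ 2 / ζ * max 1 (σ ^ 2 / (ℓ * ζ)) →
          -- iteration complexity of SGDmax with any `ζ`-accurate max-oracle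
          (∀ (Ω : Type*) [MeasurableSpace Ω] (P : Measure Ω) [IsProbabilityMeasure P]
            (x : ℕ → Ω → Minimax.Vec m) (y : ℕ → Ω → Minimax.Vec n) (ξ : ℕ → Ω → Ξ),
            Minimax.IsSGDmaxRun P μ f Y G ηx ζ x₀ x y ξ →
            ∀ T : ℕ, C * K ≤ (T : ℝ) + 1 → Minimax.ReturnsStationary P f Y ℓ x T ε) ∧
          -- stochastic gradient ascent is a `ζ`-accurate max-oracle
          (∀ (x : Minimax.Vec m) (y₀ : Minimax.Vec n), y₀ ∈ Y →
            ∀ (Ω : Type*) [MeasurableSpace Ω] (P : Measure Ω) [IsProbabilityMeasure P]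
              (ξ : ℕ → Ω → Ξ), Minimax.IsIID P μ ξ →
            ∀ N : ℕ, 1 ≤ N → C * A ≤ (N : ℝ) →
              (∀ ω, Minimax.sgaOutput Y G ηy x y₀ (fun k => ξ k ω) N ∈ Y) ∧
              Integrable (fun ω =>
                f (Minimax.pair x (Minimax.sgaOutput Y G ηy x y₀ (fun k => ξ k ω) N))) P ∧
              Minimax.Phi f Y x - ζ ≤
                ∫ ω, f (Minimax.pair x
                  (Minimax.sgaOutput Y G ηy x y₀ (fun k => ξ k ω) N)) ∂P) ∧
          -- total stochastic gradient complexity of SGDmax with this max-oracle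
          (∃ T N : ℕ, (T : ℝ) ≤ C * K ∧ 1 ≤ N ∧ (N : ℝ) ≤ C * max 1 A ∧
            ∀ (y₀ : Minimax.Vec n), y₀ ∈ Y →
            ∀ (Ω : Type*) [MeasurableSpace Ω] (P : Measure Ω) [IsProbabilityMeasure P]
              (ξ : ℕ × ℕ → Ω → Ξ), Minimax.IsIID P μ ξ →
              Minimax.IsSGDmaxRun P μ f Y G ηx ζ x₀
                (fun t ω => (Minimax.sgdmax Y G ηx ηy N x₀ y₀ (fun i => ξ i ω) t).x)
                (fun t ω => Minimax.sgaOutput Y G ηy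
                  (Minimax.sgdmax Y G ηx ηy N x₀ y₀ (fun i => ξ i ω) t).x y₀
                  (fun k => ξ (t, k) ω) N)
                (fun t ω => ξ (t, N) ω) ∧
              Minimax.ReturnsStationary P f Y ℓ
                (fun t ω => (Minimax.sgdmax Y G ηx ηy N x₀ y₀ (fun i => ξ i ω) t).x) T ε ∧
              (∀ ω, ((Minimax.sgdmax Y G ηx ηy N x₀ y₀ (fun i => ξ i ω) T).calls : ℝ) ≤
                C * (K * max 1 (ℓ ^ 2 * D ^ 2 / ε ^ 2 * max 1 (σ ^ 2 / ε ^ 2)))) ∧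
              (ε ≤ ℓ * D →
                ∀ ω, ((Minimax.sgdmax Y G ηx ηy N x₀ y₀ (fun i => ξ i ω) T).calls : ℝ) ≤
                  C * (ℓ ^ 3 * (L ^ 2 + σ ^ 2) * D ^ 2 * Minimax.envelopeGap f Y ℓ x₀ / ε ^ 6 *
                    max 1 (σ ^ 2 / ε ^ 2)))) := by
  refine ⟨100000, by norm_num, ?_⟩
  intro m n f Y ℓ L D σ ε Ξ _ μ _ G x₀ hℓ hL hσ hLσ hε h hG hb ζ ηx ηy K A hζ hηx hηy hK hA
  have hζ0 : 0 < ζ := by rw [hζ]; positivity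
  have hΔ := Minimax.IsNonconvexConcave.envelopeGap_nonneg hℓ hb x₀
  have hK0 : 0 ≤ K := by rw [hK]; positivity
  have hA0 : 0 ≤ A := by rw [hA]; positivity
  refine ⟨?_, ?_, ?_⟩
  · intro Ω _ P _ x y ξ hr T hT
    subst hζ hηx
    exact hr.returnsStationary h hL hℓ hLσ hε hb hG (by rw [← hK]; linarith)
  · intro x y₀ hy₀ Ω _ P _ ξ hξ N hN hNA
    have hmem : ∀ ω, Minimax.sgaOutput Y G ηy x y₀ (fun k => ξ k ω) N ∈ Y := fun ω =>
      Minimax.sgaOutput_mem h.nonempty h.closed h.convex hy₀ hN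
    refine ⟨hmem, h.integrable_value_of_mem x (Minimax.measurable_sgaOutput h.nonempty h.closed
      h.convex hG.measurable measurable_const fun j _ => hξ.measurable j) hmem, ?_⟩
    exact h.Phi_sub_le_integral_sgaOutput hℓ hζ0 hηy hG hξ x hy₀ hN (by rw [← hA]; linarith)
  -- Rounding down suffices because `T + 1` points are averaged. It also keeps the total
  -- proportional to `K`: for `36K < 1` no iteration is run and no gradient is used.
  · have hT1 : ((⌊36 * K⌋₊ : ℕ) : ℝ) ≤ 36 * K := Nat.floor_le (by positivity)
    have hT2 : 36 * K ≤ ((⌊36 * K⌋₊ : ℕ) : ℝ) + 1 := (Nat.lt_floor_add_one _).le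
    have hN1 : 1 ≤ max 1 ⌈2 * A⌉₊ := le_max_left _ _
    have hN2 : 2 * A ≤ ((max 1 ⌈2 * A⌉₊ : ℕ) : ℝ) :=
      (Nat.le_ceil _).trans (Nat.cast_le.2 (le_max_right _ _))
    have hN3 : ((max 1 ⌈2 * A⌉₊ : ℕ) : ℝ) ≤ 3 * max 1 A := by
      have h1 := (Nat.ceil_lt_add_one (by positivity : 0 ≤ 2 * A)).le
      have h2 := le_max_left 1 A
      have h3 := le_max_right 1 A
      push_cast
      exact max_le (by linarith) (by linarith)
    generalize ⌊36 * K⌋₊ = T at hT1 hT2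
    generalize max 1 ⌈2 * A⌉₊ = N at hN1 hN2 hN3
    refine ⟨T, N, by linarith, hN1, by linarith [le_max_left 1 A], ?_⟩
    intro y₀ hy₀ Ω _ P _ ξ hξ
    have hr := Minimax.isSGDmaxRun_sgdmax (ηx := ηx) (x₀ := x₀) h hL hℓ hζ0 hηy hG hξ hy₀ hN1
      (by rw [← hA]; exact hN2)
    have hcalls : ∀ ω,
        ((Minimax.sgdmax Y G ηx ηy N x₀ y₀ (fun i => ξ i ω) T).calls : ℝ) ≤
          100000 * (K * max 1 (ℓ ^ 2 * D ^ 2 / ε ^ 2 * max 1 (σ ^ 2 / ε ^ 2))) := fun ω => by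
      rw [Minimax.sgdmax_calls]
      refine Minimax.totalCalls_le hK0 hT1 hN3 ?_
      rw [hA, hζ]
      exact Minimax.max_one_innerComplexity_le hℓ hε
    refine ⟨hr, ?_, hcalls, fun hεD ω => (hcalls ω).trans_eq ?_⟩
    · subst hζ hηx
      exact hr.returnsStationary h hL hℓ hLσ hε hb hG (by rw [← hK]; exact hT2)
    -- For `ε ≤ ℓD` the outer maximum is its second argument, so the two bounds coincide.
    · have h1 : 1 ≤ ℓ ^ 2 * D ^ 2 / ε ^ 2 := by
        rw [one_le_div (by positivity), ← mul_pow]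
        exact pow_le_pow_left₀ hε.le hεD 2
      rw [max_eq_right (one_le_mul_of_one_le_of_one_le h1 (le_max_left _ _)), hK]
      field_simp
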